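/- Let $L\ge 1$, let $\mu:\{0,1\}^L\to\mathcal X$ be a mapping and let $W$ be a memoryless channel from $\mathcal X$ to $\mathcal Y$, given by transition probabilities (or probability densities with respect to a $\sigma$-finite reference measure on $\mathcal Y$) $W(y|x)$. For $s\in\{1,\dots,L\}$ let $W_s$ be the binary-input channel $$W_s(y|b)=\frac1{2^{L-1}}\sum_{(b_1,\dots,b_L)\in\{0,1\}^L,\ b_s=b}W(y|\mu(b_1,\dots,b_L)),\qquad \mathrm{LLR}_s(y)=\log_2\frac{W_s(y|0)}{W_s(y|1)}.$$ Let $\widetilde W(y,s|b)=\frac1L W_s(y|b)$, and let $\overline W(y,s,d|b)=\frac1{2L}W_s(y|b\oplus d)$ with $d\in\{0,1\}$. For a channel $V$ with finite input alphabet let $\mathbf C(V)=I(X;Y)$ (in bits) be its capacity with equiprobable input, i.e. the mutual information between an equiprobable input $X$ and the output $Y$. Let $\mathbf C^{\mathrm{BICM}}(W)$, the classical BICM capacity of the independent parallel channel model, be the capacity $\mathbf C$ of the channel that consists of $L$ independent uses of $\widetilde W$. Parallel BICM (PBICM) of block length $n$ uses one binary code of $M$ distinct codewords in $\{0,1\}^n$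 with one decoder $\mathrm{DEC}$ that maps vectors in $[-\infty,\infty]^n$ to messages. Independent equiprobable messages $m_1,\dots,m_L$ are encoded into codewords $\mathbf b_1,\dots,\mathbf b_L$; with independent equiprobable dither bits $d_{lk}$ and independent uniform shifts $s_k\in\mathbb Z/L$ (row indices being taken modulo $L$) put $b'_{lk}=b_{lk}\oplus d_{lk}$, and send the $n$ symbols $x_k=\mu(b'_{1+s_k,k},\dots,b'_{L+s_k,k})$ over $W$. From the output $\mathbf y$, the $l$-th decoder $\mathrm{DEC}_l=\mathrm{DEC}$ receives $z_{lk}=(-1)^{d_{lk}}\,\mathrm{LLR}_{l-s_k}(y_k)$, $k=1,\dots,n$, and outputs $\hat m_l$. The overall codeword error probability is $p_e=\Pr\{\hat m_l\neq m_l\text{ for some }l\}$, and the rate of the scheme is $L\cdot\frac1n\log_2 M$. A rate $R$ is achievable with PBICM if there are binary codes and decoders of block lengths $n=1,2,\dots$ for which the rate of the scheme tends to $R$ and $p_e\to0$ as $n\to\infty$. The PBICM capacity $\mathbf C^{\mathrm{PBICM}}(W)$ is the highest rate achievable with PBICM. Then this highest achievable rate exists (as a maximum), and $$\mathbf C^{\mathrm{PBICM}}(W)=L\cdot\mathbf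 C(\overline W)=\sum_{s=1}^L\mathbf C(W_s)=\mathbf C^{\mathrm{BICM}}(W).$$ -/

import Mathlib

open MeasureTheory Filter Topology
open scoped NNReal ENNReal BigOperators

namespace PBICM

/-- A memoryless channel with input alphabet `𝒳` and output alphabet `𝒴`. The transition
probabilities `W(y|x)` are probability densities in `y` with respect to a reference measure `ν`
(the counting measure for a discrete output, Lebesgue measure for, e.g., the AWGN channel). -/
structure Channel (𝒳 : Type*) {𝒴 : Type*} [MeasurableSpace 𝒴] (ν : Measure 𝒴) where
  /-- `density x y` is `W(y|x)`. -/
  density : 𝒳 → 𝒴 → ℝ≥0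
  measurable_density : ∀ x, Measurable (density x)
  lintegral_density : ∀ x, ∫⁻ y, (density x y : ℝ≥0∞) ∂ν = 1

namespace Channel

/-- The law of the channel output when the channel input is `x`. -/
noncomputable def law {𝒳 𝒴 : Type*} [MeasurableSpace 𝒴] {ν : Measure 𝒴}
    (W : Channel 𝒳 ν) (x : 𝒳) : Measure 𝒴 :=
  ν.withDensity (fun y => (W.density x y : ℝ≥0∞))

/-- The information density `i(x;y) = log₂ (P_{XY}(x,y) / (P_X(x) P_Y(y))) = log₂ (W(y|x) / P_Y(y))`
for an equiprobable input `X`; here `P_Y(y)` is the average of `W(y|x')` over all inputs `x'`. -/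
noncomputable def infoDensity {𝒳 𝒴 : Type*} [Fintype 𝒳] [MeasurableSpace 𝒴] {ν : Measure 𝒴}
    (W : Channel 𝒳 ν) (x : 𝒳) (y : 𝒴) : ℝ :=
  Real.logb 2 ((W.density x y : ℝ) / 𝔼 x', (W.density x' y : ℝ))

/-- The Shannon capacity with equiprobable input, in bits: the mutual information
`I(X;Y) = E[i(X;Y)]`, where `X` is equiprobable on the finite input alphabet and `Y` is the
channel output. -/
noncomputable def capacity {𝒳 𝒴 : Type*} [Fintype 𝒳] [MeasurableSpace 𝒴] {ν : Measure 𝒴}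
    (W : Channel 𝒳 ν) : ℝ :=
  𝔼 x, ∫ y, W.infoDensity x y ∂(W.law x)

/-- `n` independent uses of a channel: `Wⁿ(y|x) = ∏ₖ W(yₖ|xₖ)`. -/
noncomputable def pow {𝒳 𝒴 : Type*} [MeasurableSpace 𝒴] {ν : Measure 𝒴} [SigmaFinite ν]
    (W : Channel 𝒳 ν) (n : ℕ) :
    Channel (Fin n → 𝒳) (Measure.pi (fun _ : Fin n => ν)) where
  density x y := ∏ k, W.density (x k) (y k)
  measurable_density x :=
    Finset.measurable_fun_prod _ fun k _ =>
      (W.measurable_density (x k)).comp (measurable_pi_apply k)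
  lintegral_density x := by
    have hint : ∀ k, Integrable (fun y => (W.density (x k) y : ℝ)) ν := fun k => by
      refine ⟨(W.measurable_density (x k)).coe_nnreal_real.aestronglyMeasurable, ?_⟩
      simp [HasFiniteIntegral, enorm_eq_nnnorm, W.lintegral_density]
    have hone : ∀ k, ∫ y, (W.density (x k) y : ℝ) ∂ν = 1 := fun k => by
      rw [integral_eq_lintegral_of_nonneg_ae (ae_of_all _ fun _ => NNReal.coe_nonneg _)
        (hint k).1]
      simp [W.lintegral_density]
    have hI : Integrable (fun y : Fin n → 𝒴 => ∏ k, (W.density (x k) (y k) : ℝ))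
        (Measure.pi fun _ : Fin n => ν) :=
      Integrable.fintype_prod (f := fun k y => (W.density (x k) y : ℝ)) hint
    have h := integral_fintype_prod_eq_prod (μ := fun _ : Fin n => ν)
      (fun k y => (W.density (x k) y : ℝ))
    rw [Finset.prod_congr rfl (fun k _ => hone k), Finset.prod_const_one] at h
    have h2 := ofReal_integral_eq_lintegral_ofReal hI
      (ae_of_all _ fun y => Finset.prod_nonneg fun k _ => NNReal.coe_nonneg _)
    rw [h] at h2
    simp only [← NNReal.coe_prod, ENNReal.ofReal_coe_nnreal, ENNReal.ofReal_one] at h2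
    exact h2.symm

/-- The binary channel `W_i(y|b)`: the average of `W(y|μ(b₁,…,b_L))` over the `2^(L-1)` bit vectors
with `b_i = b`, i.e. the other bits are independent and equiprobable. -/
noncomputable def bitChannel {𝒳 𝒴 : Type*} [MeasurableSpace 𝒴] {ν : Measure 𝒴} {L : ℕ}
    (W : Channel 𝒳 ν) (μ : (Fin L → Bool) → 𝒳) (i : Fin L) : Channel Bool ν where
  density b y := (1 / 2 ^ (L - 1)) * ∑ c : Fin L → Bool with c i = b, W.density (μ c) y
  measurable_density b :=
    (Finset.measurable_fun_sum _ fun c _ => W.measurable_density (μ c)).const_mul _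
  lintegral_density b := by
    have hm : ∀ c : Fin L → Bool, Measurable fun y => (W.density (μ c) y : ℝ≥0∞) :=
      fun c => (W.measurable_density (μ c)).coe_nnreal_ennreal
    have hcard : ∀ b : Bool, (Finset.univ.filter fun c : Fin L → Bool => c i = b).card
        = 2 ^ (L - 1) := by
      have hflip : (Finset.univ.filter fun c : Fin L → Bool => c i = true).card
          = (Finset.univ.filter fun c : Fin L → Bool => c i = false).card := by
        refine Finset.card_bij' (fun c _ => Function.update c i false)
          (fun c _ => Function.update c i true) ?_ ?_ ?_ ?_ <;> intro c hc <;>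
          simp only [Finset.mem_filter, Finset.mem_univ, true_and] at hc ⊢ <;> simp [← hc]
      have hadd := Finset.card_filter_add_card_filter_not (s := Finset.univ)
        (fun c : Fin L → Bool => c i = true)
      have hpos : 0 < L := i.pos
      obtain ⟨k, rfl⟩ : ∃ k, L = k + 1 := ⟨L - 1, by omega⟩
      simp only [Bool.not_eq_true, Finset.card_univ, Fintype.card_fun, Fintype.card_bool,
        Fintype.card_fin, pow_succ] at hadd
      intro b
      cases b <;> simp only [Nat.add_sub_cancel] <;> omega
    simp only [ENNReal.coe_mul, ENNReal.ofNNReal_finsetSum]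
    rw [lintegral_const_mul _ (Finset.measurable_fun_sum _ fun c _ => hm c),
      lintegral_finsetSum _ fun c _ => hm c]
    simp only [W.lintegral_density, Finset.sum_const, hcard, nsmul_eq_mul, mul_one]
    rw [← ENNReal.coe_natCast, ← ENNReal.coe_mul]
    simp

/-- The binary channel `W̃` of the independent parallel channel model: a state `s`, uniform on the
`L` bit positions and known at the receiver, selects the channel `W_s`;
`W̃(y,s|b) = (1/L) W_s(y|b)`. -/
noncomputable def parallelChannel {𝒳 𝒴 : Type*} [MeasurableSpace 𝒴] {ν : Measure 𝒴} [SFinite ν]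
    {L : ℕ} [NeZero L] (W : Channel 𝒳 ν) (μ : (Fin L → Bool) → 𝒳) :
    Channel Bool (ν.prod (Measure.count : Measure (Fin L))) where
  density b z := (1 / (L : ℝ≥0)) * (W.bitChannel μ z.2).density b z.1
  measurable_density b := by
    refine Measurable.const_mul ?_ _
    exact measurable_from_prod_countable_left fun s => (W.bitChannel μ s).measurable_density b
  lintegral_density b := by
    have hm : Measurable fun z : 𝒴 × Fin L =>
        (((1 / (L : ℝ≥0)) * (W.bitChannel μ z.2).density b z.1 : ℝ≥0) : ℝ≥0∞) := by
      refine (Measurable.const_mul ?_ _).coe_nnreal_ennreal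
      exact measurable_from_prod_countable_left fun s => (W.bitChannel μ s).measurable_density b
    rw [lintegral_prod_symm _ hm.aemeasurable, lintegral_count, tsum_fintype]
    have h : ∀ s : Fin L, ∫⁻ y, (((1 / (L : ℝ≥0)) * (W.bitChannel μ s).density b y : ℝ≥0) : ℝ≥0∞) ∂ν
        = ((1 / (L : ℝ≥0) : ℝ≥0) : ℝ≥0∞) := fun s => by
      simp only [ENNReal.coe_mul]
      rw [lintegral_const_mul _ ((W.bitChannel μ s).measurable_density b).coe_nnreal_ennreal,
        (W.bitChannel μ s).lintegral_density, mul_one]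
    simp only [h, Finset.sum_const, Finset.card_univ, Fintype.card_fin, nsmul_eq_mul]
    rw [← ENNReal.coe_natCast, ← ENNReal.coe_mul]
    simp [NeZero.ne L]

/-- The binary channel `W̄`, with output `(Y, S, D)`: the state `S` is uniform on the `L` bit
positions, the dither `D` is an independent equiprobable bit, and `Y` is the output of `W_S` with
input `B ⊕ D`. -/
noncomputable def ditheredChannel {𝒳 𝒴 : Type*} [MeasurableSpace 𝒴] {ν : Measure 𝒴} [SFinite ν]
    {L : ℕ} [NeZero L] (W : Channel 𝒳 ν) (μ : (Fin L → Bool) → 𝒳) :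
    Channel Bool (ν.prod
      ((Measure.count : Measure (Fin L)).prod (Measure.count : Measure Bool))) where
  density b z := (1 / (L : ℝ≥0)) * (1 / 2) * (W.bitChannel μ z.2.1).density (xor b z.2.2) z.1
  measurable_density b := by
    refine Measurable.const_mul ?_ _
    exact measurable_from_prod_countable_left fun s =>
      (W.bitChannel μ s.1).measurable_density (xor b s.2)
  lintegral_density b := by
    have hm : Measurable fun z : 𝒴 × Fin L × Bool => (((1 / (L : ℝ≥0)) * (1 / 2) *
        (W.bitChannel μ z.2.1).density (xor b z.2.2) z.1 : ℝ≥0) : ℝ≥0∞) := by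
      refine (Measurable.const_mul ?_ _).coe_nnreal_ennreal
      exact measurable_from_prod_countable_left fun s =>
        (W.bitChannel μ s.1).measurable_density (xor b s.2)
    have h : ∀ (s : Fin L) (d : Bool), ∫⁻ y, (((1 / (L : ℝ≥0)) * (1 / 2) *
        (W.bitChannel μ s).density (xor b d) y : ℝ≥0) : ℝ≥0∞) ∂ν
        = ((1 / (L : ℝ≥0) * (1 / 2) : ℝ≥0) : ℝ≥0∞) := fun s d => by
      rw [← mul_one (((1 / (L : ℝ≥0) * (1 / 2) : ℝ≥0) : ℝ≥0∞)),
        ← (W.bitChannel μ s).lintegral_density (xor b d),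
        ← lintegral_const_mul _ ((W.bitChannel μ s).measurable_density _).coe_nnreal_ennreal]
      simp only [ENNReal.coe_mul]
    rw [lintegral_prod_symm _ hm.aemeasurable,
      lintegral_prod _ (measurable_of_countable _).aemeasurable, lintegral_count, tsum_fintype]
    simp only [lintegral_count, tsum_fintype, h, Finset.sum_const, Finset.card_univ,
      Fintype.card_fin, Fintype.card_bool, nsmul_eq_mul]
    rw [← ENNReal.coe_natCast, ← ENNReal.coe_natCast, ← ENNReal.coe_mul, ← ENNReal.coe_mul]
    have h0 : (L : ℝ≥0) ≠ 0 := by exact_mod_cast NeZero.ne L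
    rw [← ENNReal.coe_one, ENNReal.coe_inj]
    push_cast
    field_simp

/-- The log-likelihood ratio (base 2, with values in `[-∞, ∞]`) of the `j`-th mapper bit given the
channel output `y`: `LLR_j(y) = log₂ (W_j(y|0) / W_j(y|1))`. -/
noncomputable def bitLLR {𝒳 𝒴 : Type*} [MeasurableSpace 𝒴] {ν : Measure 𝒴} {L : ℕ}
    (W : Channel 𝒳 ν) (μ : (Fin L → Bool) → 𝒳) (j : Fin L) (y : 𝒴) : EReal :=
  ENNReal.log (((W.bitChannel μ j).density false y : ℝ≥0∞) / ((W.bitChannel μ j).density true y))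
    / ((Real.log 2 : ℝ) : EReal)

/-- The classical BICM capacity of `W` with mapping `μ` (infinite-length interleaver): in the
independent parallel channel model, the `L` bits of a channel symbol pass through `L` independent
uses of `W̃`, and `C^BICM(W)` is the capacity of this channel. -/
noncomputable def bicmCapacity {𝒳 𝒴 : Type*} [MeasurableSpace 𝒴] {ν : Measure 𝒴} [SigmaFinite ν]
    {L : ℕ} [NeZero L] (W : Channel 𝒳 ν) (μ : (Fin L → Bool) → 𝒳) : ℝ :=
  ((W.parallelChannel μ).pow L).capacity

end Channel

/-- A binary encoder-decoder pair of block length `n`: the encoder is a code consisting of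
`numMessages` distinct codewords in `{0,1}ⁿ`, and the decoder sees a vector of `n` bit metrics
(log-likelihood ratios). -/
structure BinaryCode (n : ℕ) where
  numMessages : ℕ
  enc : Fin numMessages ↪ (Fin n → Bool)
  dec : (Fin n → EReal) → Fin numMessages
  measurable_dec : Measurable dec

namespace BinaryCode

/-- The rate `(log₂ M) / n` of a binary code with `M` codewords of length `n`. -/
noncomputable def rate {n : ℕ} (C : BinaryCode n) : ℝ :=
  Real.logb 2 C.numMessages / n

/-- The `k`-th channel symbol. The codeword `enc (m l)` of each level is XORed with its dither
`d l`; the column of the `L` dithered bits at time `k` is shifted cyclically by the interleaving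
state `s k` and mapped to a channel symbol by `μ`. -/
def channelWord {𝒳 : Type*} {L n : ℕ} [NeZero L] (C : BinaryCode n) (μ : (Fin L → Bool) → 𝒳)
    (m : Fin L → Fin C.numMessages) (s : Fin n → Fin L) (d : Fin L → Fin n → Bool) :
    Fin n → 𝒳 :=
  fun k => μ fun j => xor (C.enc (m (j + s k)) k) (d (j + s k) k)

/-- The input of the `l`-th decoder. At time `k` the bit of level `l` occupies the mapper position
`l - s k`; its log-likelihood ratio is de-interleaved accordingly, and its sign is flipped if the
dither bit `d l k` is one. -/
noncomputable def decoderInput {𝒳 𝒴 : Type*} [MeasurableSpace 𝒴] {ν : Measure 𝒴} {L n : ℕ}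
    [NeZero L] (W : Channel 𝒳 ν) (μ : (Fin L → Bool) → 𝒳)
    (s : Fin n → Fin L) (d : Fin L → Fin n → Bool) (y : Fin n → 𝒴) (l : Fin L) :
    Fin n → EReal :=
  fun k => if d l k then -(W.bitLLR μ (l - s k) (y k)) else W.bitLLR μ (l - s k) (y k)

/-- The overall codeword error probability when the binary code `C` is used in parallel BICM over
`W` with mapping `μ`: the probability that at least one of the `L` decoders errs. The `L` messages,
the interleaving states and the dither bits are all independent and uniform; all levels use the
same code and the same decoder. -/
noncomputable def pbicmError {𝒳 𝒴 : Type*} [MeasurableSpace 𝒴] {ν : Measure 𝒴} [SigmaFinite ν]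
    {L n : ℕ} [NeZero L] (W : Channel 𝒳 ν) (μ : (Fin L → Bool) → 𝒳) (C : BinaryCode n) : ℝ :=
  𝔼 m : Fin L → Fin C.numMessages, 𝔼 s : Fin n → Fin L, 𝔼 d : Fin L → Fin n → Bool,
    ((W.pow n).law (C.channelWord μ m s d)).real
      {y | ∃ l, C.dec (decoderInput W μ s d y l) ≠ m l}

end BinaryCode

/-- `R` (in bits per use of `W`) is achievable with parallel BICM over `W` with mapping `μ`: there
are binary codes of block lengths `n = 0, 1, 2, …` whose parallel BICM rates, i.e. `L` times the
rates of the binary codes, converge to `R`, with vanishing overall codeword error probability. -/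
def IsAchievable {𝒳 𝒴 : Type*} [MeasurableSpace 𝒴] {ν : Measure 𝒴} [SigmaFinite ν]
    {L : ℕ} [NeZero L] (W : Channel 𝒳 ν) (μ : (Fin L → Bool) → 𝒳) (R : ℝ) : Prop :=
  ∃ C : (n : ℕ) → BinaryCode n,
    Tendsto (fun n => (L : ℝ) * (C n).rate) atTop (𝓝 R) ∧
      Tendsto (fun n => (C n).pbicmError W μ) atTop (𝓝 0)

/-- The parallel BICM capacity `C^PBICM(W)`: the highest rate achievable with parallel BICM. -/
noncomputable def pbicmCapacity {𝒳 𝒴 : Type*} [MeasurableSpace 𝒴] {ν : Measure 𝒴} [SigmaFinite ν]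
    {L : ℕ} [NeZero L] (W : Channel 𝒳 ν) (μ : (Fin L → Bool) → 𝒳) : ℝ :=
  sSup {R | IsAchievable W μ R}

end PBICM

namespace PBICM

/-! Fix a level. For given codeword bits and a given shift, the dithers of all levels make the
mapper bits uniform, whatever the other levels send. Averaged over shifts and dithers, one level
therefore sees exactly `n` independent uses of W̄ (`law_ditheredChannel_eq_sum`,
`law_pow_ditheredChannel_eq_sum`). The overall error probability lies between the error of this
binary code over W̄ and `L` times that error (`expect_levelError_le_pbicmError`, `pbicmError_le`),
so the problem becomes single-user coding over W̄.

The dither symmetrises W̄: both inputs have the same conditional mean of the information density,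
namely C(W̄). Chebyshev's inequality then gives concentration around `n` C(W̄) uniformly over
codewords. Achievability is Feinstein's greedy construction (`exists_code`); the converse is a
change of measure to the output law (`expect_success_le`). The prescribed decoder loses nothing,
because density over output density is a function of the sign-corrected LLR
(`llrRatio_ditheredLLR_mul`).

The capacity identities follow because a uniform state known to the receiver averages capacities
(`capacity_of_state`) and independent uses add them (`capacity_pow`). -/

lemma lintegral_pi_prod_coe {ι : Type*} [Fintype ι] {𝒴 : ι → Type*}
    [∀ i, MeasurableSpace (𝒴 i)] (ν : ∀ i, Measure (𝒴 i)) [∀ i, SigmaFinite (ν i)]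
    (f : ∀ i, 𝒴 i → ℝ≥0) (hf : ∀ i, Measurable (f i)) (hfin : ∀ i, ∫⁻ y, f i y ∂ν i ≠ ∞) :
    ∫⁻ y, ((∏ i, f i (y i) : ℝ≥0) : ℝ≥0∞) ∂Measure.pi ν = ∏ i, ∫⁻ y, f i y ∂ν i := by
  have hint : ∀ i, Integrable (fun y => (f i y : ℝ)) (ν i) := fun i => by
    refine ⟨(hf i).coe_nnreal_real.aestronglyMeasurable, ?_⟩
    simpa [HasFiniteIntegral, enorm_eq_nnnorm] using (hfin i).lt_top
  have hI : Integrable (fun y : ∀ i, 𝒴 i => ∏ i, (f i (y i) : ℝ)) (Measure.pi ν) :=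
    Integrable.fintype_prod_dep (f := fun i y => (f i y : ℝ)) hint
  have h := integral_fintype_prod_eq_prod (μ := ν) (fun i y => (f i y : ℝ))
  have h2 := ofReal_integral_eq_lintegral_ofReal hI
    (ae_of_all _ fun y => Finset.prod_nonneg fun k _ => NNReal.coe_nonneg _)
  have h3 : ∀ i, ENNReal.ofReal (∫ y, (f i y : ℝ) ∂ν i) = ∫⁻ y, f i y ∂ν i := fun i => by
    rw [ofReal_integral_eq_lintegral_ofReal (hint i) (ae_of_all _ fun y => NNReal.coe_nonneg _)]
    simp
  rw [h, ENNReal.ofReal_prod_of_nonneg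
    fun i _ => integral_nonneg fun y => NNReal.coe_nonneg _] at h2
  simp only [h3, ← NNReal.coe_prod, ENNReal.ofReal_coe_nnreal] at h2
  exact h2.symm

lemma expect_comp_eval {ι α : Type*} [Fintype ι] [DecidableEq ι] [Fintype α] (i : ι)
    (f : α → ℝ) : 𝔼 x : ι → α, f (x i) = 𝔼 a, f a := by
  rcases isEmpty_or_nonempty α with hα | hα
  · have : IsEmpty (ι → α) := ⟨fun x => hα.elim (x i)⟩
    simp
  rw [Fintype.expect_equiv (Equiv.funSplitAt i α) (fun x => f (x i)) (fun p => f p.1)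
    (fun x => rfl), ← Finset.univ_product_univ, Finset.expect_product]
  simp

lemma expect_prod_eval {α : Type*} [Fintype α] {n : ℕ} (f : Fin n → α → ℝ) :
    𝔼 x : Fin n → α, ∏ k, f k (x k) = ∏ k, 𝔼 a, f k a := by
  simp only [Fintype.expect_eq_sum_div_card]
  rw [Finset.prod_div_distrib, Finset.prod_univ_sum]
  simp

/-! ### Information density: second moments and product channels. -/

namespace Channel

variable {𝒳 𝒴 : Type*} [MeasurableSpace 𝒴] {ν : Measure 𝒴} (W : Channel 𝒳 ν)

instance isProbabilityMeasure_law (x : 𝒳) : IsProbabilityMeasure (W.law x) :=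
  ⟨by rw [law, withDensity_apply _ MeasurableSet.univ, Measure.restrict_univ,
    W.lintegral_density]⟩

lemma law_apply (x : 𝒳) {s : Set 𝒴} (hs : MeasurableSet s) :
    W.law x s = ∫⁻ y in s, (W.density x y : ℝ≥0∞) ∂ν :=
  withDensity_apply _ hs

lemma ae_density_ne_zero (x : 𝒳) : ∀ᵐ y ∂W.law x, W.density x y ≠ 0 := by
  have hm := (W.measurable_density x).coe_nnreal_ennreal
  rw [law, ae_withDensity_iff hm]
  exact ae_of_all _ fun y h => by simpa using h

lemma integrable_density (x : 𝒳) : Integrable (fun y => (W.density x y : ℝ)) ν := by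
  refine ⟨(W.measurable_density x).coe_nnreal_real.aestronglyMeasurable, ?_⟩
  simp [HasFiniteIntegral, enorm_eq_nnnorm, W.lintegral_density]

section Fintype

variable [Fintype 𝒳]

/-- The density of the channel output when the channel input is equiprobable. -/
noncomputable def outputDensity (y : 𝒴) : ℝ := 𝔼 x, (W.density x y : ℝ)

lemma infoDensity_eq (x : 𝒳) (y : 𝒴) :
    W.infoDensity x y = Real.logb 2 (W.density x y / W.outputDensity y) := rfl

lemma outputDensity_nonneg (y : 𝒴) : 0 ≤ W.outputDensity y :=
  Finset.expect_nonneg fun _ _ => NNReal.coe_nonneg _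

lemma density_le_card_mul_outputDensity (x : 𝒳) (y : 𝒴) :
    (W.density x y : ℝ) ≤ Fintype.card 𝒳 * W.outputDensity y := by
  have : Nonempty 𝒳 := ⟨x⟩
  rw [outputDensity, Fintype.expect_eq_sum_div_card, mul_div_cancel₀ _ (by positivity)]
  exact Finset.single_le_sum (f := fun x => (W.density x y : ℝ))
    (fun _ _ => NNReal.coe_nonneg _) (Finset.mem_univ x)

lemma outputDensity_pos {x : 𝒳} {y : 𝒴} (h : W.density x y ≠ 0) : 0 < W.outputDensity y := by
  refine (W.outputDensity_nonneg y).lt_of_ne' fun h0 => h ?_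
  have := W.density_le_card_mul_outputDensity x y
  rw [h0, mul_zero] at this
  exact_mod_cast le_antisymm this (NNReal.coe_nonneg _)

lemma measurable_outputDensity : Measurable W.outputDensity := by
  unfold outputDensity
  simp only [Fintype.expect_eq_sum_div_card]
  exact (Finset.measurable_fun_sum _ fun x _ =>
    (W.measurable_density x).coe_nnreal_real).div_const _

lemma integrable_outputDensity : Integrable W.outputDensity ν := by
  unfold outputDensity
  simp only [Fintype.expect_eq_sum_div_card]
  exact (integrable_finsetSum _ fun x _ => W.integrable_density x).div_const _

lemma measurable_infoDensity (x : 𝒳) : Measurable (W.infoDensity x) :=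
  Real.measurable_log.comp ((W.measurable_density x).coe_nnreal_real.div
    W.measurable_outputDensity) |>.div_const _

lemma two_rpow_infoDensity {x : 𝒳} {y : 𝒴} (h : W.density x y ≠ 0) :
    (2 : ℝ) ^ W.infoDensity x y = W.density x y / W.outputDensity y := by
  rw [infoDensity_eq, Real.rpow_logb (by norm_num) (by norm_num)]
  exact div_pos (NNReal.coe_pos.2 (pos_iff_ne_zero.2 h)) (W.outputDensity_pos h)

/-- Below 1, `√t |log t|` is at most 2, which gives the 4; above 1, `log t ≤ t - 1 ≤ c`, which gives
the cube. -/
lemma mul_log_sq_le {t c : ℝ} (h0 : 0 < t) (hc : 1 ≤ c) (htc : t ≤ c) :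
    t * Real.log t ^ 2 ≤ 4 + c ^ 3 := by
  rcases le_total t 1 with h1 | h1
  · have h := Real.abs_log_mul_self_rpow_lt t (1 / 2) h0 h1 (by norm_num)
    have h2 : |Real.log t * t ^ (1 / 2 : ℝ)| ^ 2 ≤ 2 ^ 2 :=
      pow_le_pow_left₀ (abs_nonneg _) (by norm_num at h ⊢; exact h.le) 2
    rw [sq_abs, mul_pow, ← Real.rpow_natCast (t ^ _), ← Real.rpow_mul h0.le] at h2
    norm_num at h2
    nlinarith [pow_pos (lt_of_lt_of_le one_pos hc) 3]
  · have hl : Real.log t ≤ c := (Real.log_le_sub_one_of_pos h0).trans (by linarith)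
    have hl0 : 0 ≤ Real.log t := Real.log_nonneg h1
    calc t * Real.log t ^ 2 ≤ c * c ^ 2 := by gcongr
      _ ≤ 4 + c ^ 3 := by nlinarith

/-- With `t` the ratio of density to output density, the integrand is the output density times `t
log² t`, up to a constant. Since `t` is at most the size of the input alphabet, this is dominated by
a multiple of the integrable output density. No moment assumption on the channel is needed. -/
lemma memLp_infoDensity (x : 𝒳) : MemLp (W.infoDensity x) 2 (W.law x) := by
  have : Nonempty 𝒳 := ⟨x⟩
  rw [memLp_two_iff_integrable_sq (W.measurable_infoDensity x).aestronglyMeasurable]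
  rw [law, integrable_withDensity_iff_integrable_smul (W.measurable_density x)]
  set c : ℝ := (4 + (Fintype.card 𝒳 : ℝ) ^ 3) / Real.log 2 ^ 2 with hc
  refine (W.integrable_outputDensity.const_mul c).mono' ?_ (ae_of_all _ fun y => ?_)
  · exact ((W.measurable_density x).smul
      ((W.measurable_infoDensity x).pow_const 2)).aestronglyMeasurable
  · rw [Real.norm_of_nonneg (by positivity), NNReal.smul_def, smul_eq_mul]
    by_cases h : W.density x y = 0
    · simp only [h, NNReal.coe_zero, zero_mul]
      exact mul_nonneg (by positivity) (W.outputDensity_nonneg y)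
    · have hq := W.outputDensity_pos h
      have hf : (0 : ℝ) < W.density x y := NNReal.coe_pos.2 (pos_iff_ne_zero.2 h)
      have hle := mul_log_sq_le (c := Fintype.card 𝒳) (div_pos hf hq)
        (by exact_mod_cast Fintype.card_pos)
        ((div_le_iff₀ hq).2 (W.density_le_card_mul_outputDensity x y))
      rw [infoDensity_eq, Real.logb, div_pow, hc]
      have hl : 0 < Real.log 2 ^ 2 := by have := Real.log_pos one_lt_two; positivity
      calc (W.density x y : ℝ) * (Real.log (W.density x y / W.outputDensity y) ^ 2
            / Real.log 2 ^ 2)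
          = ((W.density x y / W.outputDensity y) *
            Real.log (W.density x y / W.outputDensity y) ^ 2) / Real.log 2 ^ 2
            * W.outputDensity y := by field_simp
        _ ≤ _ := by gcongr

lemma integrable_infoDensity (x : 𝒳) : Integrable (W.infoDensity x) (W.law x) :=
  (W.memLp_infoDensity x).integrable (by norm_num)

end Fintype

section Pow

variable [SigmaFinite ν]

lemma law_pow (n : ℕ) (x : Fin n → 𝒳) :
    (W.pow n).law x = Measure.pi fun k => W.law (x k) := by
  refine (Measure.pi_eq fun s hs => ?_).symm
  rw [law_apply _ _ (MeasurableSet.univ_pi hs), Measure.restrict_pi_pi]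
  simp only [law_apply _ _ (hs _)]
  refine lintegral_pi_prod_coe _ (fun k => W.density (x k)) (fun k => W.measurable_density _)
    fun k => ?_
  rw [← law_apply _ _ (hs _)]
  exact measure_ne_top _ _

lemma pow_density (n : ℕ) (x : Fin n → 𝒳) (y : Fin n → 𝒴) :
    (W.pow n).density x y = ∏ k, W.density (x k) (y k) := rfl

variable [Fintype 𝒳]

lemma outputDensity_pow (n : ℕ) (y : Fin n → 𝒴) :
    (W.pow n).outputDensity y = ∏ k, W.outputDensity (y k) := by
  simp only [outputDensity, pow_density, NNReal.coe_prod]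
  exact expect_prod_eval fun k x => (W.density x (y k) : ℝ)

/-- The logarithm of a product splits only over nonzero factors, as `logb 2 0` is 0 by convention.
The excluded outputs are null under the law of `x`. -/
lemma infoDensity_pow (n : ℕ) (x : Fin n → 𝒳) (y : Fin n → 𝒴)
    (h : (W.pow n).density x y ≠ 0) :
    (W.pow n).infoDensity x y = ∑ k, W.infoDensity (x k) (y k) := by
  rw [pow_density, Finset.prod_ne_zero_iff] at h
  simp only [infoDensity_eq]
  rw [outputDensity_pow, pow_density, NNReal.coe_prod, ← Finset.prod_div_distrib, Real.logb_prod]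
  intro k hk
  exact (div_pos (NNReal.coe_pos.2 (pos_iff_ne_zero.2 (h k hk)))
    (W.outputDensity_pos (h k hk))).ne'

lemma infoDensity_pow_ae (n : ℕ) (x : Fin n → 𝒳) :
    (W.pow n).infoDensity x =ᵐ[(W.pow n).law x] fun y => ∑ k, W.infoDensity (x k) (y k) := by
  filter_upwards [(W.pow n).ae_density_ne_zero x] with y hy using W.infoDensity_pow n x y hy

lemma integral_infoDensity_pow (n : ℕ) (x : Fin n → 𝒳) :
    ∫ y, (W.pow n).infoDensity x y ∂(W.pow n).law x
      = ∑ k, ∫ y, W.infoDensity (x k) y ∂W.law (x k) := by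
  rw [integral_congr_ae (W.infoDensity_pow_ae n x), law_pow, integral_finsetSum]
  · exact Finset.sum_congr rfl fun k _ => integral_comp_eval
      (μ := fun k => W.law (x k)) (W.measurable_infoDensity (x k)).aestronglyMeasurable
  · exact fun k _ => integrable_comp_eval (μ := fun k => W.law (x k))
      (W.integrable_infoDensity (x k))

lemma variance_infoDensity_pow (n : ℕ) (x : Fin n → 𝒳) :
    ProbabilityTheory.variance ((W.pow n).infoDensity x) ((W.pow n).law x)
      = ∑ k, ProbabilityTheory.variance (W.infoDensity (x k)) (W.law (x k)) := by
  rw [ProbabilityTheory.variance_congr (W.infoDensity_pow_ae n x), law_pow,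
    ← ProbabilityTheory.variance_sum_pi (μ := fun k => W.law (x k))
      (X := fun k => W.infoDensity (x k)) fun k => W.memLp_infoDensity (x k)]
  congr 1
  ext y
  simp

/-- The capacity of `n` independent uses of a channel is `n` times its capacity. -/
lemma capacity_pow (n : ℕ) : (W.pow n).capacity = n * W.capacity := by
  simp only [capacity, integral_infoDensity_pow]
  rw [Finset.expect_sum_comm]
  simp [expect_comp_eval _ fun x => ∫ y, W.infoDensity x y ∂W.law x]

/-- Chebyshev's inequality for the information density of `n` uses of a channel all of whose
inputs have the same conditional mean `c` of the information density. -/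
lemma law_pow_abs_infoDensity_sub_ge_le {c : ℝ} (hc : ∀ x, ∫ y, W.infoDensity x y ∂W.law x = c)
    {v : ℝ} (hv : ∀ x, ProbabilityTheory.variance (W.infoDensity x) (W.law x) ≤ v)
    {n : ℕ} (hn : n ≠ 0) {δ : ℝ} (hδ : 0 < δ) (x : Fin n → 𝒳) :
    ((W.pow n).law x).real {y | n * δ ≤ |(W.pow n).infoDensity x y - n * c|}
      ≤ v / (n * δ ^ 2) := by
  have hn' : (0 : ℝ) < n := by positivity
  have h := ProbabilityTheory.meas_ge_le_variance_div_sq ((W.pow n).memLp_infoDensity x)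
    (mul_pos hn' hδ)
  rw [integral_infoDensity_pow, variance_infoDensity_pow] at h
  simp only [hc, Finset.sum_const, Finset.card_univ, Fintype.card_fin, nsmul_eq_mul] at h
  rw [measureReal_def]
  refine ENNReal.toReal_le_of_le_ofReal ?_ (h.trans (ENNReal.ofReal_le_ofReal ?_))
  · have : 0 ≤ v := (ProbabilityTheory.variance_nonneg _ _).trans (hv (x ⟨0, by omega⟩))
    positivity
  · calc _ ≤ (∑ _k : Fin n, v) / (n * δ) ^ 2 := by gcongr; exact hv _
      _ = _ := by simp; field_simp

end Pow

end Channel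

/-! ### Channels with a state known at the receiver; capacity identities. -/

namespace Channel

section State

variable {𝒜 ℬ S 𝒴 : Type*} [MeasurableSpace 𝒴] {ν : Measure 𝒴} [MeasurableSpace S] {ρ : Measure S}
  {V : Channel 𝒜 (ν.prod ρ)} {K : S → Channel ℬ ν} {σ : S → 𝒜 ≃ ℬ} {c : ℝ≥0}

/-- The state weight `c` cancels in the ratio, and the permutation `σ p` keeps an equiprobable input
equiprobable. -/
lemma infoDensity_of_state [Fintype 𝒜] [Fintype ℬ] (hc : c ≠ 0)
    (hV : ∀ a y p, V.density a (y, p) = c * (K p).density (σ p a) y) (a : 𝒜) (y : 𝒴) (p : S) :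
    V.infoDensity a (y, p) = (K p).infoDensity (σ p a) y := by
  have h : V.outputDensity (y, p) = c * (K p).outputDensity y := by
    simp only [outputDensity, hV, NNReal.coe_mul, ← Finset.mul_expect]
    rw [Fintype.expect_equiv (σ p) _ (fun b => ((K p).density b y : ℝ)) fun a => rfl]
  rw [infoDensity_eq, infoDensity_eq, h, hV, NNReal.coe_mul,
    mul_div_mul_left _ _ (NNReal.coe_ne_zero.2 hc)]

variable [SFinite ν] [SFinite ρ] [Fintype S]

/-- A channel whose output contains a state, uniform and known at the receiver, is the mixture of
the channels selected by the state. -/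
lemma law_eq_sum_of_state (hρ : ∀ f : S → ℝ≥0∞, ∫⁻ p, f p ∂ρ = ∑ p, f p)
    (hV : ∀ a y p, V.density a (y, p) = c * (K p).density (σ p a) y) (a : 𝒜) :
    V.law a = ∑ p, (c : ℝ≥0∞) • ((K p).law (σ p a)).map fun y => (y, p) := by
  ext E hE
  have hm : Measurable (E.indicator fun z => (V.density a z : ℝ≥0∞)) :=
    (V.measurable_density a).coe_nnreal_ennreal.indicator hE
  rw [law_apply _ _ hE, ← lintegral_indicator hE, lintegral_prod_symm _ hm.aemeasurable, hρ]
  simp only [Measure.finsetSum_apply, Measure.smul_apply, smul_eq_mul]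
  refine Finset.sum_congr rfl fun p _ => ?_
  have hEp : MeasurableSet ((fun y : 𝒴 => (y, p)) ⁻¹' E) := measurable_prodMk_right hE
  rw [Measure.map_apply measurable_prodMk_right hE, law_apply _ _ hEp,
    ← lintegral_const_mul _ ((K p).measurable_density _).coe_nnreal_ennreal,
    ← lintegral_indicator hEp]
  refine lintegral_congr fun y => ?_
  by_cases h : (y, p) ∈ E <;> simp [h, hV]

variable [Fintype 𝒜] [Fintype ℬ]

lemma integral_infoDensity_of_state (hρ : ∀ f : S → ℝ≥0∞, ∫⁻ p, f p ∂ρ = ∑ p, f p) (hc : c ≠ 0)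
    (hV : ∀ a y p, V.density a (y, p) = c * (K p).density (σ p a) y) (a : 𝒜) :
    ∫ z, V.infoDensity a z ∂V.law a
      = ∑ p, c * ∫ y, (K p).infoDensity (σ p a) y ∂(K p).law (σ p a) := by
  have hp : ∀ p : S, Measurable fun y : 𝒴 => (y, p) := fun p => measurable_prodMk_right
  have hcomp : ∀ p : S, V.infoDensity a ∘ (fun y => (y, p)) = (K p).infoDensity (σ p a) :=
    fun p => funext fun y => infoDensity_of_state hc hV a y p
  rw [law_eq_sum_of_state hρ hV, integral_finsetSum_measure]
  · refine Finset.sum_congr rfl fun p _ => ?_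
    rw [integral_smul_measure, integral_map (hp p).aemeasurable
      (V.measurable_infoDensity a).aestronglyMeasurable]
    simp only [infoDensity_of_state hc hV, ENNReal.coe_toReal, smul_eq_mul]
  · intro p _
    refine Integrable.smul_measure ?_ ENNReal.coe_ne_top
    rw [integrable_map_measure (V.measurable_infoDensity a).aestronglyMeasurable
      (hp p).aemeasurable, hcomp]
    exact (K p).integrable_infoDensity _

/-- Applied with `c = 1/L` and trivial `σ` to W̃, and with `c = 1/(2L)` and `σ` the dither to W̄.
Stating `hρ` as a sum formula covers both a counting measure and a product of counting measures. -/
lemma capacity_of_state (hρ : ∀ f : S → ℝ≥0∞, ∫⁻ p, f p ∂ρ = ∑ p, f p) (hc : c ≠ 0)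
    (hV : ∀ a y p, V.density a (y, p) = c * (K p).density (σ p a) y) :
    V.capacity = c * ∑ p, (K p).capacity := by
  simp only [capacity, integral_infoDensity_of_state hρ hc hV]
  rw [Finset.expect_sum_comm, Finset.mul_sum]
  refine Finset.sum_congr rfl fun p _ => ?_
  rw [← Finset.mul_expect]
  rw [Fintype.expect_equiv (σ p) _
    (fun b => ∫ y, (K p).infoDensity b y ∂(K p).law b) fun a => rfl]

end State

/-- Addition modulo two with a dither bit. -/
def xorEquiv (d : Bool) : Bool ≃ Bool where
  toFun b := xor b d
  invFun b := xor b d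
  left_inv b := by simp
  right_inv b := by simp

@[simp]
lemma xorEquiv_apply (d b : Bool) : xorEquiv d b = xor b d := rfl

lemma lintegral_count_prod_count {α β : Type*} [Fintype α] [Fintype β] [MeasurableSpace α]
    [MeasurableSpace β] [DiscreteMeasurableSpace α] [DiscreteMeasurableSpace β]
    (f : α × β → ℝ≥0∞) :
    ∫⁻ p, f p ∂(Measure.count : Measure α).prod (Measure.count : Measure β) = ∑ p, f p := by
  rw [lintegral_prod _ (measurable_of_countable _).aemeasurable, Fintype.sum_prod_type]
  simp [lintegral_count, tsum_fintype]

section Dithered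

variable {𝒳 𝒴 : Type*} [MeasurableSpace 𝒴] {ν : Measure 𝒴} [SFinite ν] {L : ℕ} [NeZero L]
  (W : Channel 𝒳 ν) (μ : (Fin L → Bool) → 𝒳)

lemma parallelChannel_density (b : Bool) (y : 𝒴) (s : Fin L) :
    (W.parallelChannel μ).density b (y, s)
      = 1 / (L : ℝ≥0) * (W.bitChannel μ s).density (Equiv.refl Bool b) y := rfl

lemma ditheredChannel_density (b : Bool) (y : 𝒴) (p : Fin L × Bool) :
    (W.ditheredChannel μ).density b (y, p)
      = 1 / (L : ℝ≥0) * (1 / 2) * (W.bitChannel μ p.1).density (xorEquiv p.2 b) y := rfl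

lemma capacity_parallelChannel :
    (W.parallelChannel μ).capacity = 1 / L * ∑ s, (W.bitChannel μ s).capacity := by
  have h0 : (1 : ℝ≥0) / L ≠ 0 := by simp [NeZero.ne L]
  rw [capacity_of_state (K := W.bitChannel μ) (σ := fun _ => Equiv.refl Bool)
    (fun f => by rw [lintegral_count, tsum_fintype]) h0 (W.parallelChannel_density μ)]
  simp

lemma capacity_ditheredChannel :
    (W.ditheredChannel μ).capacity = 1 / L * ∑ s, (W.bitChannel μ s).capacity := by
  have h0 : (1 : ℝ≥0) / L * (1 / 2) ≠ 0 := by simp [NeZero.ne L]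
  rw [capacity_of_state (K := fun p : Fin L × Bool => W.bitChannel μ p.1)
    (σ := fun p => xorEquiv p.2) lintegral_count_prod_count h0 (W.ditheredChannel_density μ),
    Fintype.sum_prod_type]
  simp [← Finset.mul_sum]
  ring

lemma law_ditheredChannel (b : Bool) :
    (W.ditheredChannel μ).law b = ∑ p : Fin L × Bool, ((1 / (L : ℝ≥0) * (1 / 2) : ℝ≥0) : ℝ≥0∞) •
      ((W.bitChannel μ p.1).law (xor b p.2)).map fun y => (y, p) :=
  law_eq_sum_of_state (K := fun p : Fin L × Bool => W.bitChannel μ p.1)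
    (σ := fun p => xorEquiv p.2) lintegral_count_prod_count (W.ditheredChannel_density μ) b

/-- Thanks to the dither, both inputs of the dithered channel have the same conditional mean of the
information density. -/
lemma integral_infoDensity_ditheredChannel (b : Bool) :
    ∫ z, (W.ditheredChannel μ).infoDensity b z ∂(W.ditheredChannel μ).law b
      = (W.ditheredChannel μ).capacity := by
  have h0 : (1 : ℝ≥0) / L * (1 / 2) ≠ 0 := by simp [NeZero.ne L]
  rw [capacity_ditheredChannel, integral_infoDensity_of_state
    (K := fun p : Fin L × Bool => W.bitChannel μ p.1) (σ := fun p => xorEquiv p.2)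
    lintegral_count_prod_count h0 (W.ditheredChannel_density μ), Fintype.sum_prod_type,
    Finset.mul_sum]
  refine Finset.sum_congr rfl fun s _ => ?_
  rw [capacity, Fintype.expect_eq_sum_div_card]
  -- As the dither takes both values, its sum with `b` runs over both bits, so the two cases differ
  -- only in the order of the terms.
  cases b <;> simp <;> ring

end Dithered

/-- The classical BICM capacity is the sum of the capacities of the bit channels. -/
lemma bicmCapacity_eq {𝒳 𝒴 : Type*} [MeasurableSpace 𝒴] {ν : Measure 𝒴} [SigmaFinite ν] {L : ℕ}
    [NeZero L] (W : Channel 𝒳 ν) (μ : (Fin L → Bool) → 𝒳) :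
    W.bicmCapacity μ = ∑ s, (W.bitChannel μ s).capacity := by
  have h0 : (L : ℝ) ≠ 0 := by exact_mod_cast NeZero.ne L
  rw [bicmCapacity, capacity_pow, capacity_parallelChannel]
  field_simp

lemma law_bitChannel {𝒳 𝒴 : Type*} [MeasurableSpace 𝒴] {ν : Measure 𝒴} {L : ℕ}
    (W : Channel 𝒳 ν) (μ : (Fin L → Bool) → 𝒳) (i : Fin L) (b : Bool) {E : Set 𝒴}
    (hE : MeasurableSet E) :
    (W.bitChannel μ i).law b E
      = ((1 / 2 ^ (L - 1) : ℝ≥0) : ℝ≥0∞) * ∑ c : Fin L → Bool with c i = b, W.law (μ c) E := by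
  have hm : ∀ c : Fin L → Bool, Measurable fun y => (W.density (μ c) y : ℝ≥0∞) :=
    fun c => (W.measurable_density (μ c)).coe_nnreal_ennreal
  simp only [law_apply _ _ hE, bitChannel, ENNReal.coe_mul, ENNReal.ofNNReal_finsetSum]
  rw [lintegral_const_mul _ (Finset.measurable_fun_sum _ fun c _ => hm c),
    lintegral_finsetSum _ fun c _ => hm c]

end Channel

/-! ### One-shot converse and Feinstein's lemma. -/

namespace Channel

variable {𝒳 𝒴 : Type*} [MeasurableSpace 𝒴] {ν : Measure 𝒴} (W : Channel 𝒳 ν) [Fintype 𝒳]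

/-- The law of the channel output when the channel input is equiprobable. -/
noncomputable def outputLaw : Measure 𝒴 :=
  ν.withDensity fun y => ENNReal.ofReal (W.outputDensity y)

lemma outputLaw_apply {s : Set 𝒴} (hs : MeasurableSet s) :
    W.outputLaw s = ENNReal.ofReal (𝔼 x, (W.law x).real s) := by
  rw [outputLaw, withDensity_apply _ hs, ← ofReal_integral_eq_lintegral_ofReal
    W.integrable_outputDensity.integrableOn (ae_of_all _ W.outputDensity_nonneg)]
  congr 1
  simp only [outputDensity, Fintype.expect_eq_sum_div_card]
  rw [integral_div, integral_finsetSum _ fun x _ => (W.integrable_density x).integrableOn]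
  congr 1
  refine Finset.sum_congr rfl fun x _ => ?_
  rw [measureReal_def, law_apply _ _ hs, integral_eq_lintegral_of_nonneg_ae
    (ae_of_all _ fun _ => NNReal.coe_nonneg _)
    (W.integrable_density x).integrableOn.aestronglyMeasurable]
  simp

instance isFiniteMeasure_outputLaw : IsFiniteMeasure W.outputLaw :=
  ⟨by rw [W.outputLaw_apply MeasurableSet.univ]; exact ENNReal.ofReal_lt_top⟩

lemma outputLaw_real {s : Set 𝒴} (hs : MeasurableSet s) :
    W.outputLaw.real s = 𝔼 x, (W.law x).real s := by
  rw [measureReal_def, outputLaw_apply _ hs, ENNReal.toReal_ofReal]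
  exact Finset.expect_nonneg fun _ _ => measureReal_nonneg

/-- A set on which the density exceeds `a` times the output density has small output probability. -/
lemma outputLaw_real_le_of_mul_le {a : ℝ} (ha : 0 < a) (x : 𝒳) {s : Set 𝒴}
    (hs : MeasurableSet s) (h : ∀ y ∈ s, a * W.outputDensity y ≤ W.density x y) :
    W.outputLaw.real s ≤ a⁻¹ := by
  refine ENNReal.toReal_le_of_le_ofReal (by positivity) ?_
  rw [outputLaw, withDensity_apply _ hs]
  calc ∫⁻ y in s, ENNReal.ofReal (W.outputDensity y) ∂ν
      ≤ ∫⁻ y in s, ENNReal.ofReal a⁻¹ * W.density x y ∂ν := by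
        refine setLIntegral_mono' hs fun y hy => ?_
        rw [← ENNReal.ofReal_coe_nnreal, ← ENNReal.ofReal_mul (by positivity)]
        refine ENNReal.ofReal_le_ofReal ?_
        rw [inv_mul_eq_div, le_div_iff₀ ha, mul_comm]
        exact h y hy
    _ = ENNReal.ofReal a⁻¹ * W.law x s := by
        rw [lintegral_const_mul _ (W.measurable_density x).coe_nnreal_ennreal, law_apply _ _ hs]
    _ ≤ ENNReal.ofReal a⁻¹ * 1 := by gcongr; exact prob_le_one
    _ = _ := mul_one _

/-- Change of measure from a conditional law to the output law. -/
lemma law_real_le (t : ℝ) (x : 𝒳) {s : Set 𝒴} (hs : MeasurableSet s) :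
    (W.law x).real s
      ≤ (W.law x).real {y | t < W.infoDensity x y} + 2 ^ t * W.outputLaw.real s := by
  have hm : MeasurableSet {y | t < W.infoDensity x y} :=
    measurableSet_lt measurable_const (W.measurable_infoDensity x)
  -- Off the exceptional set the density is at most `2 ^ t` times the output density.
  have hbound : W.law x (s \ {y | t < W.infoDensity x y})
      ≤ ENNReal.ofReal (2 ^ t) * W.outputLaw s := by
    rw [law_apply _ _ (hs.diff hm), outputLaw, withDensity_apply _ hs,
      ← lintegral_const_mul _ W.measurable_outputDensity.ennreal_ofReal]
    refine (setLIntegral_mono' (hs.diff hm) fun y hy => ?_).trans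
      (lintegral_mono_set Set.sdiff_subset)
    rw [← ENNReal.ofReal_coe_nnreal, ← ENNReal.ofReal_mul (by positivity)]
    refine ENNReal.ofReal_le_ofReal ?_
    by_cases h : W.density x y = 0
    · rw [h]
      exact mul_nonneg (by positivity) (W.outputDensity_nonneg y)
    · rw [← div_le_iff₀ (W.outputDensity_pos h), ← W.two_rpow_infoDensity h]
      exact Real.rpow_le_rpow_of_exponent_le (by norm_num) (not_lt.1 hy.2)
  have hbound' : (W.law x).real (s \ {y | t < W.infoDensity x y})
      ≤ 2 ^ t * W.outputLaw.real s := by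
    have := ENNReal.toReal_mono (by finiteness) hbound
    rwa [ENNReal.toReal_mul, ENNReal.toReal_ofReal (by positivity)] at this
  calc (W.law x).real s
      ≤ (W.law x).real ({y | t < W.infoDensity x y} ∪ s \ {y | t < W.infoDensity x y}) :=
        measureReal_mono (by rw [Set.union_sdiff_self]; exact Set.subset_union_right)
    _ ≤ _ := (measureReal_union_le _ _).trans (by gcongr)

/-- Converse: the average success probability of a code with `M` messages. -/
lemma expect_success_le {M : ℕ} (t η : ℝ) (enc : Fin M → 𝒳) (dec : 𝒴 → Fin M)
    (hdec : Measurable dec)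
    (hη : ∀ x, (W.law x).real {y | t < W.infoDensity x y} ≤ η) (hM : 0 < M) :
    𝔼 i, (W.law (enc i)).real (dec ⁻¹' {i}) ≤ η + 2 ^ t / M := by
  have : Nonempty (Fin M) := ⟨⟨0, hM⟩⟩
  have hmeas : ∀ i, MeasurableSet (dec ⁻¹' {i}) := fun i => hdec (measurableSet_singleton i)
  -- The decision regions are disjoint, so their output probabilities add up to at most 1; this
  -- produces the factor `1 / M`.
  have hsum : ∑ i, W.outputLaw.real (dec ⁻¹' {i}) ≤ 1 := by
    have : Nonempty 𝒳 := ⟨enc ⟨0, hM⟩⟩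
    rw [← measureReal_biUnion_finset (fun i _ j _ hij => Disjoint.preimage _ (by simpa using hij))
      fun i _ => hmeas i]
    rw [outputLaw_real _ (Finset.measurableSet_biUnion _ fun i _ => hmeas i)]
    exact Finset.expect_le Finset.univ_nonempty fun x _ => measureReal_le_one
  calc 𝔼 i, (W.law (enc i)).real (dec ⁻¹' {i})
      ≤ 𝔼 i, (η + 2 ^ t * W.outputLaw.real (dec ⁻¹' {i})) := by
        refine Finset.expect_le_expect fun i _ => ?_
        exact (W.law_real_le t (enc i) (hmeas i)).trans (by gcongr; exact hη _)
    _ = η + 2 ^ t * (∑ i, W.outputLaw.real (dec ⁻¹' {i})) / M := by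
        rw [Finset.expect_add_distrib, Fintype.expect_const, ← Finset.mul_expect,
          Fintype.expect_eq_sum_div_card, Fintype.card_fin, mul_div_assoc]
    _ ≤ η + 2 ^ t * 1 / M := by gcongr
    _ = _ := by rw [mul_one]

/-- Feinstein's lemma: greedy choice of codewords with small maximal error probability. -/
lemma exists_greedy_codewords [Nonempty 𝒳] (B : 𝒳 → Set 𝒴) (hB : ∀ x, MeasurableSet (B x))
    {η β : ℝ} (hη : ∀ x, (W.law x).real (B x)ᶜ ≤ η) (hβ : ∀ x, W.outputLaw.real (B x) ≤ β)
    (k : ℕ) {ε : ℝ} (hε : η + k * β ≤ ε) (hβ0 : 0 ≤ β) :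
    ∃ x : ℕ → 𝒳, ∀ i < k, (W.law (x i)).real (B (x i) \ ⋃ j < i, B (x j))ᶜ ≤ ε := by
  induction k with
  | zero => exact ⟨fun _ => Classical.arbitrary 𝒳, by simp⟩
  | succ k ih =>
    obtain ⟨x, hx⟩ := ih (by push_cast at hε; linarith)
    set D : Set 𝒴 := ⋃ j < k, B (x j) with hD
    have hDm : MeasurableSet D := MeasurableSet.iUnion fun j => MeasurableSet.iUnion fun _ => hB _
    have hDle : W.outputLaw.real D ≤ k * β := by
      have : D = ⋃ j ∈ Finset.range k, B (x j) := by simp [hD]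
      rw [this]
      refine (measureReal_biUnion_finset_le _ _).trans ?_
      refine (Finset.sum_le_sum fun j _ => hβ (x j)).trans ?_
      simp
    -- Averaging the conditional laws over an equiprobable `a` gives the output law, under which the
    -- occupied set `D` has mass at most `k * β`. Hence some input still has most of its region
    -- free.
    have havg : 𝔼 a, (W.law a).real (B a \ D)ᶜ ≤ ε := by
      calc 𝔼 a, (W.law a).real (B a \ D)ᶜ ≤ 𝔼 a, (η + (W.law a).real D) := by
            refine Finset.expect_le_expect fun a _ => ?_
            have : (B a \ D)ᶜ = (B a)ᶜ ∪ D := by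
              rw [Set.sdiff_eq, Set.compl_inter, compl_compl]
            rw [this]
            exact (measureReal_union_le _ _).trans (by gcongr; exact hη a)
        _ = η + W.outputLaw.real D := by
            rw [Finset.expect_add_distrib, Fintype.expect_const, outputLaw_real _ hDm]
        _ ≤ ε := by push_cast at hε; linarith
    obtain ⟨a, -, ha⟩ := Finset.exists_le_of_expect_le Finset.univ_nonempty havg
    refine ⟨Function.update x k a, fun i hi => ?_⟩
    have hU : ∀ i ≤ k, (⋃ j < i, B (Function.update x k a j)) = ⋃ j < i, B (x j) :=
      fun i hik => Set.iUnion₂_congr fun j hj => by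
        rw [Function.update_of_ne (by omega)]
    rw [hU i (by omega)]
    rcases Nat.lt_succ_iff_lt_or_eq.1 hi with h | rfl
    · rw [Function.update_of_ne (by omega)]
      exact hx i h
    · rw [Function.update_self]
      exact ha

/-- Direct part: a code with `M` distinct codewords whose decoder only uses a sufficient statistic
`T`; the likelihood ratio is a function `r` of this statistic. -/
lemma exists_code [Nonempty 𝒳] {𝒵 : Type*} [MeasurableSpace 𝒵] {T : 𝒴 → 𝒵} (hT : Measurable T)
    (r : 𝒳 → 𝒵 → ℝ) (hr : ∀ x, Measurable (r x))
    (hrT : ∀ x y, 0 < W.outputDensity y → r x (T y) * W.outputDensity y = W.density x y)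
    {M : ℕ} (hM : 0 < M) (t η : ℝ)
    (hη : ∀ x, (W.law x).real {y | W.infoDensity x y ≤ t} ≤ η)
    (hε : η + M * 2 ^ (-t) < 1) :
    ∃ (enc : Fin M ↪ 𝒳) (dec : 𝒵 → Fin M), Measurable dec ∧
      ∀ i, (W.law (enc i)).real {y | dec (T y) ≠ i} ≤ η + M * 2 ^ (-t) := by
  classical
  -- The threshold test "information density above `t`", written in terms of the statistic, so that
  -- the decision regions live in `𝒵`.
  set A : 𝒳 → Set 𝒵 := fun x => {z | 2 ^ t < r x z} with hA
  have hAm : ∀ x, MeasurableSet (A x) := fun x => measurableSet_lt measurable_const (hr x)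
  have hηB : ∀ x, (W.law x).real (T ⁻¹' A x)ᶜ ≤ η := fun x => by
    refine le_trans ?_ (hη x)
    refine ENNReal.toReal_mono (measure_ne_top _ _) (measure_mono_ae ?_)
    filter_upwards [W.ae_density_ne_zero x] with y hy hyA
    have hq := W.outputDensity_pos hy
    have h1 : r x (T y) ≤ 2 ^ t := not_lt.1 hyA
    have h2 : (2 : ℝ) ^ W.infoDensity x y ≤ 2 ^ t := by
      rw [W.two_rpow_infoDensity hy, ← hrT x y hq, mul_div_cancel_right₀ _ hq.ne']
      exact h1
    exact (Real.rpow_le_rpow_left_iff (by norm_num)).1 h2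
  have hβB : ∀ x, W.outputLaw.real (T ⁻¹' A x) ≤ 2 ^ (-t) := fun x => by
    rw [Real.rpow_neg (by norm_num)]
    refine W.outputLaw_real_le_of_mul_le (by positivity) x (hT (hAm x)) fun y hy => ?_
    rcases (W.outputDensity_nonneg y).eq_or_lt with h0 | h0
    · rw [← h0, mul_zero]
      exact NNReal.coe_nonneg _
    · rw [← hrT x y h0]
      gcongr
      exact le_of_lt hy
  obtain ⟨x, hx⟩ := W.exists_greedy_codewords (fun x => T ⁻¹' A x) (fun x => hT (hAm x)) hηB hβB M
    le_rfl (by positivity)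
  -- A repeated codeword would have an empty decision region and error probability 1, contrary to
  -- `hε`.
  have hne : ∀ i < M, ∀ j < i, x i ≠ x j := fun i hi j hj h => by
    have hemp : (T ⁻¹' A (x i) \ ⋃ j < i, T ⁻¹' A (x j)) = ∅ := by
      rw [Set.sdiff_eq_empty]
      exact h ▸ Set.subset_iUnion₂ (s := fun j _ => T ⁻¹' A (x j)) j hj
    have := hx i hi
    rw [hemp, Set.compl_empty, probReal_univ] at this
    linarith
  have hinj : Function.Injective fun i : Fin M => x i := fun i j hij => by
    rcases lt_trichotomy i j with h | h | h
    · exact absurd hij.symm (hne j j.2 i h)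
    · exact h
    · exact absurd hij (hne i i.2 j h)
  have hD : Pairwise (Function.onFun Disjoint
      fun i : Fin M => A (x i) \ ⋃ j < (i : ℕ), A (x j)) := by
    have key : ∀ i j : Fin M, i < j → Disjoint (A (x i) \ ⋃ j < (i : ℕ), A (x j))
        (A (x j) \ ⋃ k < (j : ℕ), A (x k)) := fun i j hij =>
      Set.disjoint_left.2 fun z hz hz' => hz'.2 (Set.mem_iUnion₂.2 ⟨i, hij, hz.1⟩)
    intro i j hij
    rcases lt_or_gt_of_ne hij with h | h
    · exact key i j h
    · exact (key j i h).symm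
  have hDm : ∀ i : Fin M, MeasurableSet (A (x i) \ ⋃ j < (i : ℕ), A (x j)) := fun i =>
    (hAm _).diff (MeasurableSet.iUnion fun j => MeasurableSet.iUnion fun _ => hAm _)
  have : Nonempty (Fin M) := ⟨⟨0, hM⟩⟩
  obtain ⟨dec, hdec, hdecD⟩ := exists_measurable_piecewise
    (fun i : Fin M => A (x i) \ ⋃ j < (i : ℕ), A (x j)) hDm (fun i _ => i)
    (fun i => measurable_const) (fun i j hij z hz => absurd hz.2 (fun h =>
      Set.disjoint_left.1 (hD hij) hz.1 h))
  refine ⟨⟨fun i => x i, hinj⟩, dec, hdec, fun i => ?_⟩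
  refine (measureReal_mono ?_ (measure_ne_top _ _)).trans (hx i i.2)
  intro y hy hyD
  refine hy (hdecD i ?_)
  simpa using hyD

end Channel

/-! ### The log-likelihood ratio as a sufficient statistic. -/

namespace Channel

section Statistic

variable {𝒳 𝒴 : Type*} [MeasurableSpace 𝒴] {ν : Measure 𝒴} {L : ℕ}
  (W : Channel 𝒳 ν) (μ : (Fin L → Bool) → 𝒳)

lemma measurable_bitLLR (j : Fin L) : Measurable (W.bitLLR μ j) := by
  have h0 : (0 : EReal) ≤ (Real.log 2 : ℝ) :=
    EReal.coe_nonneg.2 (Real.log_nonneg one_le_two)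
  refine (EReal.monotone_div_right_of_nonneg h0).measurable.comp (Measurable.ennreal_log ?_)
  exact ((W.bitChannel μ j).measurable_density false).coe_nnreal_ennreal.div
    ((W.bitChannel μ j).measurable_density true).coe_nnreal_ennreal

/-- The bit metric computed from an output of the dithered channel. -/
noncomputable def ditheredLLR (z : 𝒴 × Fin L × Bool) : EReal :=
  if z.2.2 then -(W.bitLLR μ z.2.1 z.1) else W.bitLLR μ z.2.1 z.1

lemma measurable_ditheredLLR : Measurable (W.ditheredLLR μ) := by
  refine measurable_from_prod_countable_left fun p => ?_
  unfold ditheredLLR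
  rcases p with ⟨s, d⟩
  cases d <;> simpa using W.measurable_bitLLR μ s

/-- The ratio of the conditional density given the input `b` and the output density, as a function
of the log-likelihood ratio. -/
noncomputable def llrRatio (b : Bool) (z : EReal) : ℝ :=
  -- For bit densities `u`, `v` and `λ = u / v = 2 ^ z`, the ratio of `u` to `(u + v) / 2` is `2 /
  -- (1 + λ⁻¹)`. In `ℝ≥0∞` this also covers `λ = 0` and `λ = ∞`.
  (2 * (1 + ((EReal.exp (if b then -z else z)) ^ Real.log 2)⁻¹)⁻¹).toReal

lemma measurable_llrRatio (b : Bool) : Measurable (llrRatio b) := by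
  unfold llrRatio
  have h : Measurable fun z : EReal => if b then -z else z := by
    cases b <;> simp <;> fun_prop
  exact ((((h.ereal_exp.pow_const _).inv.const_add _).inv).const_mul _).ennreal_toReal

lemma toReal_two_mul_inv_one_add_inv_mul {a b : ℝ≥0} (h : 0 < a + b) :
    (2 * (1 + ((a : ℝ≥0∞) / b)⁻¹)⁻¹).toReal * (((a : ℝ) + b) / 2) = a := by
  rcases eq_or_ne a 0 with rfl | ha
  · simp only [zero_add] at h
    simp
  · have h1 : ((a : ℝ≥0∞) / b)⁻¹ = ((b / a : ℝ≥0) : ℝ≥0∞) := by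
      rw [ENNReal.inv_div (Or.inl ENNReal.coe_ne_top) (Or.inr (by simpa using ha)),
        ENNReal.coe_div ha]
    have h2 : (2 * (1 + ((a : ℝ≥0∞) / b)⁻¹)⁻¹) = ((2 * (1 + b / a)⁻¹ : ℝ≥0) : ℝ≥0∞) := by
      rw [h1, ENNReal.coe_mul, ENNReal.coe_inv (by positivity)]
      simp
    have ha' : (a : ℝ) ≠ 0 := NNReal.coe_ne_zero.2 ha
    have hab : (a : ℝ) + b ≠ 0 := by exact_mod_cast h.ne'
    rw [h2, ENNReal.coe_toReal]
    push_cast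
    field_simp

lemma exp_div_log_two_rpow (x : ℝ≥0∞) :
    EReal.exp (ENNReal.log x / ((Real.log 2 : ℝ) : EReal)) ^ Real.log 2 = x := by
  rw [← EReal.exp_mul, EReal.div_mul_cancel (EReal.coe_ne_bot _) (EReal.coe_ne_top _)
    (by simp [(Real.log_pos one_lt_two).ne']), ENNReal.exp_log]

lemma llrRatio_false_bitLLR_mul (s : Fin L) (y : 𝒴) {a b : ℝ≥0}
    (ha : (W.bitChannel μ s).density false y = a) (hb : (W.bitChannel μ s).density true y = b)
    (h : 0 < a + b) : llrRatio false (W.bitLLR μ s y) * (((a : ℝ) + b) / 2) = a := by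
  rw [llrRatio, bitLLR, ha, hb]
  simp only [Bool.false_eq_true, if_false, exp_div_log_two_rpow]
  exact toReal_two_mul_inv_one_add_inv_mul h

lemma llrRatio_true_bitLLR_mul (s : Fin L) (y : 𝒴) {a b : ℝ≥0}
    (ha : (W.bitChannel μ s).density false y = a) (hb : (W.bitChannel μ s).density true y = b)
    (h : 0 < a + b) : llrRatio true (W.bitLLR μ s y) * (((a : ℝ) + b) / 2) = b := by
  have h' : 0 < b + a := by rwa [add_comm]
  rw [add_comm (a : ℝ), llrRatio, bitLLR, ha, hb]
  simp only [if_true, EReal.exp_neg, ENNReal.inv_rpow, exp_div_log_two_rpow]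
  rcases eq_or_ne a 0 with rfl | ha0
  · have hb0 : b ≠ 0 := by simpa using h'.ne'
    simp
    ring
  · rw [ENNReal.inv_div (Or.inr ENNReal.coe_ne_top) (Or.inr (by simpa using ha0))]
    exact toReal_two_mul_inv_one_add_inv_mul h'

/-- Negating the LLR exchanges the two inputs, which is why the receiver can undo a dither bit by a
sign flip. -/
lemma llrRatio_not_neg (b : Bool) (z : EReal) : llrRatio b (-z) = llrRatio (!b) z := by
  cases b <;> simp [llrRatio]

variable [NeZero L]

/-- State and dither enter the likelihood ratio only through the bit metric. Positivity of the
output density excludes outputs where both bit densities vanish and the LLR has only a default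
value. -/
lemma llrRatio_ditheredLLR_mul [SFinite ν] (b : Bool) (z : 𝒴 × Fin L × Bool)
    (hz : 0 < (W.ditheredChannel μ).outputDensity z) :
    llrRatio b (W.ditheredLLR μ z) * (W.ditheredChannel μ).outputDensity z
      = (W.ditheredChannel μ).density b z := by
  obtain ⟨y, s, d⟩ := z
  set u := (W.bitChannel μ s).density false y with hu
  set v := (W.bitChannel μ s).density true y with hv
  have hq : (W.ditheredChannel μ).outputDensity (y, s, d)
      = 1 / L * (1 / 2) * (((u : ℝ) + v) / 2) := by
    rw [outputDensity, Fintype.expect_eq_sum_div_card]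
    simp only [ditheredChannel_density, xorEquiv_apply, Fintype.sum_bool, Fintype.card_bool]
    cases d <;> simp [hu, hv] <;> ring
  have huv : 0 < u + v := by
    refine pos_iff_ne_zero.2 fun h => hz.ne' ?_
    rw [hq, ← NNReal.coe_add, h]
    simp
  have h0 := W.llrRatio_false_bitLLR_mul μ s y hu.symm hv.symm huv
  have h1 := W.llrRatio_true_bitLLR_mul μ s y hu.symm hv.symm huv
  rw [hq, mul_left_comm, ditheredChannel_density, ditheredLLR]
  push_cast
  congr 1
  cases b <;> cases d <;> simp [llrRatio_not_neg, h0, h1, ← hu, ← hv]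

end Statistic

/-! ### The channel seen by one level after shifting and dithering. -/

section Interleaving

/-- The vector of outputs of the dithered channels seen by level `l`. -/
def levelOutput {𝒴 : Type*} {L n : ℕ} (l : Fin L) (s : Fin n → Fin L) (d : Fin L → Fin n → Bool)
    (y : Fin n → 𝒴) : Fin n → 𝒴 × Fin L × Bool :=
  fun k => (y k, l - s k, d l k)

lemma measurable_levelOutput {𝒴 : Type*} [MeasurableSpace 𝒴] {L n : ℕ} (l : Fin L) (s : Fin n → Fin L) (d : Fin L → Fin n → Bool) :
    Measurable (levelOutput l s d : (Fin n → 𝒴) → _) :=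
  measurable_pi_iff.2 fun k => (measurable_pi_apply k).prodMk measurable_const

variable {𝒳 𝒴 : Type*} [MeasurableSpace 𝒴] {ν : Measure 𝒴} {L : ℕ} [NeZero L]
  (W : Channel 𝒳 ν) (μ : (Fin L → Bool) → 𝒳)

/-- The dithered and cyclically shifted column of mapper bits. -/
def mapperBits (γ : Fin L → Bool) (s : Fin L) (δ : Fin L → Bool) : Fin L → Bool :=
  fun j => xor (γ (j + s)) (δ (j + s))

/-- For fixed codeword bits and shift, the dithered column is a bijective function of the dithers,
and level `l` sits at position `l - s`. Uniform dithers thus give uniform mapper bits. -/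
lemma sum_mapperBits {M : Type*} [AddCommMonoid M] (γ : Fin L → Bool) (l s : Fin L)
    (f : (Fin L → Bool) → Bool → M) :
    ∑ δ : Fin L → Bool, f (mapperBits γ s δ) (δ l)
      = ∑ c : Fin L → Bool, f c (xor (γ l) (c (l - s))) := by
  refine Finset.sum_bij' (fun δ _ => mapperBits γ s δ)
    (fun c _ => fun i => xor (γ i) (c (i - s))) (fun _ _ => Finset.mem_univ _)
    (fun _ _ => Finset.mem_univ _) ?_ ?_ ?_
  · intro δ _
    ext i
    simp [mapperBits]
  · intro c _
    ext i
    simp [mapperBits]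
  · intro δ _
    simp [mapperBits]

/-- The channel seen by one level: averaged over the interleaving state and the dithers of all
levels, it is the dithered channel. -/
lemma law_ditheredChannel_eq_sum [SFinite ν] (γ : Fin L → Bool) (l : Fin L)
    {E : Set (𝒴 × Fin L × Bool)} (hE : MeasurableSet E) :
    (W.ditheredChannel μ).law (γ l) E = ∑ s : Fin L, ∑ δ : Fin L → Bool,
      ((1 / (L * 2 ^ L) : ℝ≥0) : ℝ≥0∞) *
        W.law (μ (mapperBits γ s δ)) ((fun y => (y, l - s, δ l)) ⁻¹' E) := by
  have hEp : ∀ p : Fin L × Bool, MeasurableSet ((fun y : 𝒴 => (y, p)) ⁻¹' E) :=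
    fun p => measurable_prodMk_right hE
  -- State and dither of W̄ weigh `1/(2L)`, the remaining mapper bits `1/2^(L-1)`; together this is
  -- the uniform weight on shifts and dither columns.
  have hL : (1 / (L : ℝ≥0) * (1 / 2)) * (1 / 2 ^ (L - 1)) = 1 / (L * 2 ^ L) := by
    rw [← mul_pow_sub_one (NeZero.ne L) (2 : ℝ≥0)]
    have : (L : ℝ≥0) ≠ 0 := by exact_mod_cast NeZero.ne L
    field_simp
  rw [law_ditheredChannel, Measure.finsetSum_apply, Fintype.sum_prod_type]
  simp only [Measure.smul_apply, smul_eq_mul, Measure.map_apply measurable_prodMk_right hE,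
    law_bitChannel _ _ _ _ (hEp _), ← mul_assoc, ← ENNReal.coe_mul, hL]
  rw [← Equiv.sum_comp (Equiv.subLeft l)]
  refine Finset.sum_congr rfl fun s _ => ?_
  rw [sum_mapperBits γ l s fun c d => ((1 / (L * 2 ^ L) : ℝ≥0) : ℝ≥0∞) *
    W.law (μ c) ((fun y => (y, l - s, d)) ⁻¹' E)]
  simp only [Finset.mul_sum, Finset.sum_filter, Equiv.subLeft_apply]
  rw [Finset.sum_comm]
  refine Finset.sum_congr rfl fun c _ => ?_
  -- Given the mapper bits, exactly one dither value of level `l` is compatible with its codeword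
  -- bit.
  rw [Finset.sum_eq_single (xor (γ l) (c (l - s)))]
  · simp
  · intro d _ hd
    rw [if_neg fun h => hd (by rw [h]; simp), mul_zero]
  · simp

/-- On rectangles the product over time of the single-use identities expands into a sum over all
shift sequences and dither arrays, because these are independent over time. -/
lemma law_pow_ditheredChannel_eq_sum [SigmaFinite ν] {n : ℕ} (c : Fin L → Fin n → Bool)
    (l : Fin L) :
    ((W.ditheredChannel μ).pow n).law (c l) =
      ∑ s : Fin n → Fin L, ∑ d : Fin L → Fin n → Bool,
        (((1 / (L * 2 ^ L)) ^ n : ℝ≥0) : ℝ≥0∞) •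
          ((W.pow n).law fun k => μ (mapperBits (fun i => c i k) (s k) fun i => d i k)).map
            (levelOutput l s d) := by
  rw [law_pow]
  refine Measure.pi_eq fun E hE => ?_
  have hEn : MeasurableSet (Set.pi Set.univ E) := MeasurableSet.univ_pi hE
  simp only [Measure.finsetSum_apply, Measure.smul_apply, smul_eq_mul,
    Measure.map_apply (measurable_levelOutput l _ _) hEn]
  have hpre : ∀ (s : Fin n → Fin L) (d : Fin L → Fin n → Bool),
      (levelOutput l s d : (Fin n → 𝒴) → _) ⁻¹' Set.pi Set.univ E
        = Set.pi Set.univ fun k => (fun y => (y, l - s k, d l k)) ⁻¹' E k := fun s d => by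
    ext y
    simp [levelOutput]
  simp only [hpre, law_pow, Measure.pi_pi]
  rw [Finset.prod_congr rfl fun k _ =>
    W.law_ditheredChannel_eq_sum μ (fun i => c i k) l (hE k)]
  simp only [Fintype.prod_sum]
  refine Finset.sum_congr rfl fun s _ => ?_
  rw [← Equiv.sum_comp (Equiv.piComm fun (_ : Fin L) (_ : Fin n) => Bool)]
  refine Finset.sum_congr rfl fun d _ => ?_
  rw [Finset.prod_mul_distrib, Finset.prod_const, Finset.card_univ, Fintype.card_fin,
    ENNReal.coe_pow]
  rfl

end Interleaving

end Channel

/-! ### Overall error probability against the error over the dithered channel. -/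

namespace BinaryCode

open Channel

variable {𝒳 𝒴 : Type*} [MeasurableSpace 𝒴] {ν : Measure 𝒴} {L n : ℕ}
  (W : Channel 𝒳 ν) (μ : (Fin L → Bool) → 𝒳)

/-- The vector of bit metrics computed from the outputs of `n` uses of the dithered channel. -/
noncomputable def llrVector (z : Fin n → 𝒴 × Fin L × Bool) : Fin n → EReal :=
  fun k => W.ditheredLLR μ (z k)

lemma measurable_llrVector : Measurable (llrVector W μ : (Fin n → 𝒴 × Fin L × Bool) → _) :=
  measurable_pi_iff.2 fun k => (W.measurable_ditheredLLR μ).comp (measurable_pi_apply k)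

variable [SigmaFinite ν] [NeZero L] (C : BinaryCode n)

/-- The average over the interleaving states and the dithers of the law of the decoder input of
level `l`. -/
lemma expect_law_decoderInput (m : Fin L → Fin C.numMessages) (l : Fin L)
    {A : Set (Fin n → EReal)} (hA : MeasurableSet A) :
    𝔼 s : Fin n → Fin L, 𝔼 d : Fin L → Fin n → Bool,
      ((W.pow n).law (C.channelWord μ m s d)).real {y | decoderInput W μ s d y l ∈ A}
      = (((W.ditheredChannel μ).pow n).law (C.enc (m l))).real (llrVector W μ ⁻¹' A) := by
  have hA' := measurable_llrVector W μ hA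
  rw [measureReal_def, W.law_pow_ditheredChannel_eq_sum μ (fun i k => C.enc (m i) k) l]
  simp only [Measure.finsetSum_apply, Measure.smul_apply, smul_eq_mul,
    Measure.map_apply (measurable_levelOutput l _ _) hA', ← Finset.mul_sum]
  rw [ENNReal.toReal_mul, ENNReal.toReal_sum fun s _ =>
    ENNReal.sum_ne_top.2 fun d _ => measure_ne_top _ _]
  simp only [ENNReal.toReal_sum fun d _ => measure_ne_top _ _, Fintype.expect_eq_sum_div_card,
    ← Finset.sum_div, div_div, ENNReal.coe_toReal]
  rw [div_eq_inv_mul]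
  -- Metrics computed from `levelOutput` agree with `decoderInput` by definition. What remains is
  -- that the number of shifts and dithers, `L^n * (2^n)^L`, is the inverse of the weight.
  congr 1
  simp only [Fintype.card_fun, Fintype.card_fin, Fintype.card_bool]
  push_cast
  rw [one_div, inv_pow, mul_pow, ← pow_mul, ← pow_mul, mul_comm n L, mul_comm]

/-- The error probability of message `i` when the code is used over the dithered channel. -/
noncomputable def levelError (i : Fin C.numMessages) : ℝ :=
  (((W.ditheredChannel μ).pow n).law (C.enc i)).real {z | C.dec (llrVector W μ z) ≠ i}

lemma measurableSet_dec_ne (i : Fin C.numMessages) : MeasurableSet {z | C.dec z ≠ i} :=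
  C.measurable_dec (measurableSet_singleton i).compl

lemma expect_levelError (l : Fin L) :
    𝔼 m : Fin L → Fin C.numMessages, 𝔼 s : Fin n → Fin L, 𝔼 d : Fin L → Fin n → Bool,
      ((W.pow n).law (C.channelWord μ m s d)).real {y | C.dec (decoderInput W μ s d y l) ≠ m l}
      = 𝔼 i, C.levelError W μ i := by
  rw [← expect_comp_eval l (C.levelError W μ)]
  refine Finset.expect_congr rfl fun m _ => ?_
  rw [levelError]
  exact expect_law_decoderInput W μ C m l (A := {z | C.dec z ≠ m l}) (C.measurableSet_dec_ne (m l))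

/-- The levels are dependent, but bounding below by one level and above by the union bound involves
only their marginals. -/
lemma expect_levelError_le_pbicmError : 𝔼 i, C.levelError W μ i ≤ C.pbicmError W μ := by
  rw [← C.expect_levelError W μ 0]
  refine Finset.expect_le_expect fun m _ => Finset.expect_le_expect fun s _ =>
    Finset.expect_le_expect fun d _ => measureReal_mono fun y hy => ⟨0, hy⟩

lemma pbicmError_le : C.pbicmError W μ ≤ L * 𝔼 i, C.levelError W μ i := by
  have h : (L : ℝ) * 𝔼 i, C.levelError W μ i = ∑ _l : Fin L, 𝔼 i, C.levelError W μ i := by simp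
  rw [h, ← Finset.sum_congr rfl fun l _ => C.expect_levelError W μ l]
  simp only [← Finset.expect_sum_comm]
  refine Finset.expect_le_expect fun m _ => Finset.expect_le_expect fun s _ =>
    Finset.expect_le_expect fun d _ => ?_
  rw [Set.ofPred_exists]
  exact measureReal_iUnion_fintype_le _

end BinaryCode

open Channel

/-! ### Coding theorem: converse, achievability at capacity. -/

section Coding

variable {𝒳 𝒴 : Type*} [MeasurableSpace 𝒴] {ν : Measure 𝒴} [SigmaFinite ν] {L : ℕ} [NeZero L]
  (W : Channel 𝒳 ν) (μ : (Fin L → Bool) → 𝒳)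

/-- A bound on the conditional variances of the information density of the dithered channel. -/
noncomputable def infoVariance : ℝ :=
  ∑ b, ProbabilityTheory.variance ((W.ditheredChannel μ).infoDensity b)
    ((W.ditheredChannel μ).law b)

/-- The bound does not depend on the codeword `x`. This is the gain from the dither: it applies to
arbitrary codes in the converse and to every candidate codeword in the greedy construction. -/
lemma law_pow_ditheredChannel_abs_sub_ge_le {n : ℕ} (hn : n ≠ 0) {δ : ℝ} (hδ : 0 < δ)
    (x : Fin n → Bool) :
    (((W.ditheredChannel μ).pow n).law x).real
      {y | n * δ ≤ |((W.ditheredChannel μ).pow n).infoDensity x y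
        - n * (W.ditheredChannel μ).capacity|} ≤ infoVariance W μ / (n * δ ^ 2) :=
  (W.ditheredChannel μ).law_pow_abs_infoDensity_sub_ge_le
    (W.integral_infoDensity_ditheredChannel μ)
    (fun b => Finset.single_le_sum
      (f := fun b => ProbabilityTheory.variance ((W.ditheredChannel μ).infoDensity b)
        ((W.ditheredChannel μ).law b))
      (fun _ _ => ProbabilityTheory.variance_nonneg _ _) (Finset.mem_univ b)) hn hδ x

lemma law_pow_ditheredChannel_infoDensity_le {n : ℕ} (hn : n ≠ 0) {δ : ℝ} (hδ : 0 < δ)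
    (x : Fin n → Bool) :
    (((W.ditheredChannel μ).pow n).law x).real
      {y | ((W.ditheredChannel μ).pow n).infoDensity x y
        ≤ n * ((W.ditheredChannel μ).capacity - δ)} ≤ infoVariance W μ / (n * δ ^ 2) := by
  refine (measureReal_mono ?_ (measure_ne_top _ _)).trans
    (law_pow_ditheredChannel_abs_sub_ge_le W μ hn hδ x)
  intro y hy
  rw [Set.mem_ofPred_eq] at hy ⊢
  exact le_trans (by linarith) (neg_le_abs _)

lemma law_pow_ditheredChannel_lt_infoDensity {n : ℕ} (hn : n ≠ 0) {δ : ℝ} (hδ : 0 < δ)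
    (x : Fin n → Bool) :
    (((W.ditheredChannel μ).pow n).law x).real
      {y | n * ((W.ditheredChannel μ).capacity + δ)
        < ((W.ditheredChannel μ).pow n).infoDensity x y} ≤ infoVariance W μ / (n * δ ^ 2) := by
  refine (measureReal_mono ?_ (measure_ne_top _ _)).trans
    (law_pow_ditheredChannel_abs_sub_ge_le W μ hn hδ x)
  intro y hy
  rw [Set.mem_ofPred_eq] at hy ⊢
  exact le_trans (by linarith) (le_abs_self _)

lemma llrRatio_llrVector_mul {n : ℕ} (x : Fin n → Bool) (y : Fin n → 𝒴 × Fin L × Bool)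
    (hy : 0 < ((W.ditheredChannel μ).pow n).outputDensity y) :
    (∏ k, llrRatio (x k) (BinaryCode.llrVector W μ y k))
      * ((W.ditheredChannel μ).pow n).outputDensity y
      = ((W.ditheredChannel μ).pow n).density x y := by
  rw [outputDensity_pow] at hy ⊢
  rw [← Finset.prod_mul_distrib, pow_density, NNReal.coe_prod]
  refine Finset.prod_congr rfl fun k _ => W.llrRatio_ditheredLLR_mul μ (x k) (y k) ?_
  exact (outputDensity_nonneg _ _).lt_of_ne'
    ((Finset.prod_ne_zero_iff.1 hy.ne') k (Finset.mem_univ k))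

lemma exists_binaryCode {n : ℕ} (hn : n ≠ 0) {δ : ℝ} (hδ : 0 < δ) {M : ℕ} (hM : 0 < M)
    (hε : infoVariance W μ / (n * δ ^ 2)
      + M * 2 ^ (-(n * ((W.ditheredChannel μ).capacity - δ))) < 1) :
    ∃ C : BinaryCode n, C.numMessages = M ∧ C.pbicmError W μ ≤
      L * (infoVariance W μ / (n * δ ^ 2)
        + M * 2 ^ (-(n * ((W.ditheredChannel μ).capacity - δ)))) := by
  set V := W.ditheredChannel μ with hV
  have : Nonempty (Fin M) := ⟨⟨0, hM⟩⟩
  obtain ⟨enc, dec, hdec, herr⟩ := (V.pow n).exists_code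
    (BinaryCode.measurable_llrVector W μ) (fun x z => ∏ k, llrRatio (x k) (z k))
    (fun x => Finset.measurable_fun_prod _ fun k _ =>
      (measurable_llrRatio (x k)).comp (measurable_pi_apply k))
    (llrRatio_llrVector_mul W μ)
    hM (n * (V.capacity - δ)) (infoVariance W μ / (n * δ ^ 2))
    (law_pow_ditheredChannel_infoDensity_le W μ hn hδ)
    hε
  refine ⟨⟨M, enc, dec, hdec⟩, rfl, (BinaryCode.pbicmError_le W μ _).trans ?_⟩
  gcongr
  exact Finset.expect_le Finset.univ_nonempty fun i _ => herr i

lemma BinaryCode.numMessages_pos {n : ℕ} (C : BinaryCode n) : 0 < C.numMessages :=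
  Fin.pos (C.dec 0)

/-- A lower bound on the error probability of every code. -/
lemma one_sub_le_pbicmError {n : ℕ} (hn : n ≠ 0) {δ : ℝ} (hδ : 0 < δ) (C : BinaryCode n) :
    1 - infoVariance W μ / (n * δ ^ 2)
      - 2 ^ (n * ((W.ditheredChannel μ).capacity + δ)) / C.numMessages ≤ C.pbicmError W μ := by
  refine le_trans ?_ (C.expect_levelError_le_pbicmError W μ)
  set V := W.ditheredChannel μ with hV
  have hM := C.numMessages_pos
  have : Nonempty (Fin C.numMessages) := ⟨⟨0, hM⟩⟩
  have hdec : Measurable fun z => C.dec (BinaryCode.llrVector W μ z) :=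
    C.measurable_dec.comp (BinaryCode.measurable_llrVector W μ)
  have h := (V.pow n).expect_success_le (n * (V.capacity + δ)) (infoVariance W μ / (n * δ ^ 2))
    C.enc _ hdec
    (law_pow_ditheredChannel_lt_infoDensity W μ hn hδ) hM
  have hcompl : ∀ i, C.levelError W μ i = 1 - ((V.pow n).law (C.enc i)).real
      ((fun z => C.dec (BinaryCode.llrVector W μ z)) ⁻¹' {i}) := fun i => by
    rw [← probReal_compl_eq_one_sub (hdec (measurableSet_singleton i))]
    rfl
  simp only [hcompl, Finset.expect_sub_distrib, Fintype.expect_const]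
  linarith

/-- The code with a single message. -/
def trivialCode (n : ℕ) : BinaryCode n where
  numMessages := 1
  enc := ⟨fun _ _ => false, Function.injective_of_subsingleton _⟩
  dec _ := 0
  measurable_dec := measurable_const

/-- Used twice: with the converse it shows that the capacity is nonnegative, and it settles
achievability when the capacity is 0. -/
lemma isAchievable_zero : IsAchievable W μ 0 := by
  refine ⟨trivialCode, ?_, ?_⟩
  · simp [BinaryCode.rate, trivialCode]
  · have h : ∀ n, (trivialCode n).pbicmError W μ = 0 := fun n => by
      refine Finset.expect_eq_zero fun m _ => Finset.expect_eq_zero fun s _ =>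
        Finset.expect_eq_zero fun d _ => ?_
      convert! measureReal_empty
      exact Set.eq_empty_of_forall_notMem fun y ⟨l, hl⟩ =>
        hl (Subsingleton.elim (α := Fin 1) _ _)
    simp [h]

lemma tendsto_div_natCast_mul (v : ℝ) {δ : ℝ} (hδ : 0 < δ) :
    Tendsto (fun n : ℕ => v / (n * δ ^ 2)) atTop (𝓝 0) :=
  (tendsto_natCast_atTop_atTop.atTop_mul_const (pow_pos hδ 2)).const_div_atTop v

lemma tendsto_two_rpow_neg {f : ℕ → ℝ} (hf : Tendsto f atTop atTop) :
    Tendsto (fun n => (2 : ℝ) ^ (-f n)) atTop (𝓝 0) :=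
  (tendsto_rpow_atBot_of_base_gt_one 2 one_lt_two).comp (tendsto_neg_atTop_atBot.comp hf)

/-- Converse part of the coding theorem. -/
lemma IsAchievable.le_capacity {R : ℝ} (hR : IsAchievable W μ R) :
    R ≤ L * (W.ditheredChannel μ).capacity := by
  obtain ⟨C, hrate, herr⟩ := hR
  set c := (W.ditheredChannel μ).capacity with hc
  have hL : (0 : ℝ) < L := by exact_mod_cast NeZero.pos L
  by_contra! hlt
  -- A quarter of the gap per level: the code rate eventually exceeds `c + 2 * δ`, while the
  -- information density rarely exceeds `n * (c + δ)`.
  obtain ⟨δ, hδ, hδR⟩ : ∃ δ : ℝ, 0 < δ ∧ L * (c + 2 * δ) < R := by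
    refine ⟨(R - L * c) / (4 * L), by have := sub_pos.2 hlt; positivity, ?_⟩
    field_simp
    linarith
  have hlow : Tendsto (fun n : ℕ => 1 - infoVariance W μ / (n * δ ^ 2) - (2 : ℝ) ^ (-(n * δ)))
      atTop (𝓝 (1 - 0 - 0)) :=
    (tendsto_const_nhds.sub (tendsto_div_natCast_mul _ hδ)).sub
      (tendsto_two_rpow_neg (tendsto_natCast_atTop_atTop.atTop_mul_const hδ))
  have hle : ∀ᶠ n : ℕ in atTop, 1 - infoVariance W μ / (n * δ ^ 2) - (2 : ℝ) ^ (-(n * δ))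
      ≤ (C n).pbicmError W μ := by
    filter_upwards [hrate.eventually_const_lt hδR, eventually_ge_atTop 1] with n hn hn1
    refine le_trans ?_ (one_sub_le_pbicmError W μ (by omega) hδ (C n))
    have hM : (0 : ℝ) < (C n).numMessages := by exact_mod_cast (C n).numMessages_pos
    have hn0 : (0 : ℝ) < n := by exact_mod_cast hn1
    have h1 : n * (c + 2 * δ) < Real.logb 2 (C n).numMessages := by
      have := lt_of_mul_lt_mul_left hn hL.le
      rwa [BinaryCode.rate, lt_div_iff₀ hn0, mul_comm] at this
    have h2 : (2 : ℝ) ^ (n * (c + 2 * δ)) ≤ (C n).numMessages :=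
      ((Real.lt_logb_iff_rpow_lt one_lt_two hM).1 h1).le
    have h3 : (2 : ℝ) ^ (n * (c + δ)) / (C n).numMessages ≤ 2 ^ (-(n * δ)) := by
      rw [div_le_iff₀ hM]
      calc (2 : ℝ) ^ (n * (c + δ)) = 2 ^ (-(n * δ)) * 2 ^ (n * (c + 2 * δ)) := by
            rw [← Real.rpow_add two_pos]
            ring_nf
        _ ≤ _ := by gcongr
    gcongr
  -- In the limit this reads `1 ≤ 0`.
  have := le_of_tendsto_of_tendsto hlow herr hle
  norm_num at this

/-- A number that is at least 1 loses at most a factor 2, that is one bit, under the floor. -/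
lemma logb_floor_two_rpow_ge {x : ℝ} (hx : 0 ≤ x) : x - 1 ≤ Real.logb 2 ⌊(2 : ℝ) ^ x⌋₊ := by
  have h1 : 1 ≤ (2 : ℝ) ^ x := Real.one_le_rpow one_le_two hx
  have h2 : 1 ≤ ⌊(2 : ℝ) ^ x⌋₊ := Nat.one_le_floor_iff _ |>.2 h1
  have h3 : (1 : ℝ) ≤ ⌊(2 : ℝ) ^ x⌋₊ := by exact_mod_cast h2
  have h4 := Nat.lt_floor_add_one ((2 : ℝ) ^ x)
  rw [Real.le_logb_iff_rpow_le one_lt_two (by linarith), Real.rpow_sub_one two_ne_zero]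
  linarith

lemma logb_floor_two_rpow_le {x : ℝ} (hx : 0 ≤ x) : Real.logb 2 ⌊(2 : ℝ) ^ x⌋₊ ≤ x := by
  have h1 : 1 ≤ (2 : ℝ) ^ x := Real.one_le_rpow one_le_two hx
  have h2 : 0 < ⌊(2 : ℝ) ^ x⌋₊ := Nat.floor_pos.2 h1
  rw [Real.logb_le_iff_le_rpow one_lt_two (by exact_mod_cast h2)]
  exact Nat.floor_le (by positivity)

/-- Direct part of the coding theorem. -/
lemma isAchievable_capacity : IsAchievable W μ (L * (W.ditheredChannel μ).capacity) := by
  have hL : (0 : ℝ) < L := by exact_mod_cast NeZero.pos L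
  have hc0 : 0 ≤ (W.ditheredChannel μ).capacity :=
    nonneg_of_mul_nonneg_right (isAchievable_zero W μ).le_capacity hL
  set c := (W.ditheredChannel μ).capacity with hc
  rcases hc0.eq_or_lt with h0 | hcpos
  · rw [← h0, mul_zero]
    exact isAchievable_zero W μ
  -- The exponent makes `δ n → 0` while `n * δ n` and `n * δ n ^ 2` tend to infinity. A margin that
  -- shrinks with `n` attains the capacity itself, so the supremum is a maximum.
  set δ : ℕ → ℝ := fun n => (n : ℝ) ^ (-(1 / 4) : ℝ) with hδ
  have hδ0 : Tendsto δ atTop (𝓝 0) :=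
    (tendsto_rpow_neg_atTop (by norm_num)).comp tendsto_natCast_atTop_atTop
  have hδ1 : Tendsto (fun n : ℕ => n * δ n) atTop atTop := by
    refine ((tendsto_rpow_atTop (y := 3 / 4) (by norm_num)).comp
      tendsto_natCast_atTop_atTop).congr' ?_
    filter_upwards [eventually_gt_atTop 0] with n hn
    have hn0 : (0 : ℝ) < n := by exact_mod_cast hn
    simp only [hδ, Function.comp]
    rw [← Real.rpow_one_add' hn0.le (by norm_num)]
    norm_num
  have hδ2 : Tendsto (fun n : ℕ => n * δ n ^ 2) atTop atTop := by
    refine ((tendsto_rpow_atTop (y := 1 / 2) (by norm_num)).comp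
      tendsto_natCast_atTop_atTop).congr' ?_
    filter_upwards [eventually_gt_atTop 0] with n hn
    have hn0 : (0 : ℝ) < n := by exact_mod_cast hn
    simp only [hδ, Function.comp]
    rw [← Real.rpow_mul_natCast hn0.le, ← Real.rpow_one_add' hn0.le (by norm_num)]
    norm_num
  set ε : ℕ → ℝ := fun n => infoVariance W μ / (n * δ n ^ 2) + 2 ^ (-(n * δ n)) with hε
  have hε0 : Tendsto ε atTop (𝓝 0) := by
    simpa using (hδ2.const_div_atTop (infoVariance W μ)).add (tendsto_two_rpow_neg hδ1)
  -- One `δ n` is spent on the decoding threshold; the other makes the confusion term at most `2 ^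
  -- (-(n * δ n))`.
  set x : ℕ → ℝ := fun n => n * (c - 2 * δ n) with hx
  have hx0 : ∀ᶠ n in atTop, 0 ≤ x n := by
    filter_upwards [hδ0.eventually_lt_const (show 0 < c / 2 by linarith)] with n hn
    exact mul_nonneg n.cast_nonneg (by linarith)
  -- A code is needed at every length; the finitely many lengths where the construction fails get
  -- the trivial code.
  have hex : ∀ n, ∃ C : BinaryCode n, (n ≠ 0 ∧ 0 ≤ x n ∧ ε n < 1) →
      C.numMessages = ⌊(2 : ℝ) ^ x n⌋₊ ∧ C.pbicmError W μ ≤ L * ε n := fun n => by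
    by_cases h : n ≠ 0 ∧ 0 ≤ x n ∧ ε n < 1
    · obtain ⟨hn, hxn, hεn⟩ := h
      have hδn : 0 < δ n := by
        have : (0 : ℝ) < n := by positivity
        exact Real.rpow_pos_of_pos this _
      have hM : 0 < ⌊(2 : ℝ) ^ x n⌋₊ := Nat.floor_pos.2 (Real.one_le_rpow one_le_two hxn)
      have hle : infoVariance W μ / (n * δ n ^ 2)
          + (⌊(2 : ℝ) ^ x n⌋₊ : ℝ) * 2 ^ (-(n * (c - δ n))) ≤ ε n := by
        simp only [hε]
        gcongr
        calc (⌊(2 : ℝ) ^ x n⌋₊ : ℝ) * 2 ^ (-(n * (c - δ n)))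
            ≤ 2 ^ x n * 2 ^ (-(n * (c - δ n))) := by
              gcongr
              exact Nat.floor_le (by positivity)
          _ = 2 ^ (-(n * δ n)) := by
              rw [← Real.rpow_add two_pos]
              simp only [hx]
              ring_nf
      obtain ⟨C, hCM, hCe⟩ := exists_binaryCode W μ hn hδn hM (hle.trans_lt hεn)
      exact ⟨C, fun _ => ⟨hCM, hCe.trans (by gcongr)⟩⟩
    · exact ⟨trivialCode n, fun h' => absurd h' h⟩
  choose C hC using hex
  have hev : ∀ᶠ n in atTop, n ≠ 0 ∧ 0 ≤ x n ∧ ε n < 1 := by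
    filter_upwards [eventually_ne_atTop 0, hx0, hε0.eventually_lt_const one_pos] with n h1 h2 h3
    exact ⟨h1, h2, h3⟩
  refine ⟨C, Tendsto.const_mul _ ?_, ?_⟩
  · have hup : Tendsto (fun n => c - 2 * δ n) atTop (𝓝 c) := by
      simpa using tendsto_const_nhds.sub (hδ0.const_mul 2)
    have hlow : Tendsto (fun n : ℕ => c - 2 * δ n - 1 / n) atTop (𝓝 c) := by
      simpa using hup.sub tendsto_one_div_atTop_nhds_zero_nat
    refine tendsto_of_tendsto_of_tendsto_of_le_of_le' hlow hup ?_ ?_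
    · filter_upwards [hev] with n hn
      have hn0 : (0 : ℝ) < n := by have := hn.1; positivity
      rw [BinaryCode.rate, (hC n hn).1, le_div_iff₀ hn0]
      refine le_trans (le_of_eq ?_) (logb_floor_two_rpow_ge hn.2.1)
      simp only [hx]
      field_simp
    · filter_upwards [hev] with n hn
      have hn0 : (0 : ℝ) < n := by have := hn.1; positivity
      rw [BinaryCode.rate, (hC n hn).1, div_le_iff₀ hn0, mul_comm]
      exact logb_floor_two_rpow_le hn.2.1
  · refine squeeze_zero' (Eventually.of_forall fun n => ?_)
      (hev.mono fun n hn => (hC n hn).2) (by simpa using hε0.const_mul (L : ℝ))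
    exact Finset.expect_nonneg fun _ _ => Finset.expect_nonneg fun _ _ =>
      Finset.expect_nonneg fun _ _ => measureReal_nonneg

end Coding

end PBICM

theorem theorem2 {𝒳 𝒴 : Type*} [MeasurableSpace 𝒴] (ν : Measure 𝒴) [SigmaFinite ν]
    (L : ℕ) [NeZero L] (W : PBICM.Channel 𝒳 ν) (μ : (Fin L → Bool) → 𝒳) :
    IsGreatest {R : ℝ | PBICM.IsAchievable W μ R} (PBICM.pbicmCapacity W μ) ∧
      PBICM.pbicmCapacity W μ = L * (W.ditheredChannel μ).capacity ∧
      L * (W.ditheredChannel μ).capacity = ∑ s : Fin L, (W.bitChannel μ s).capacity ∧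
      ∑ s : Fin L, (W.bitChannel μ s).capacity = W.bicmCapacity μ := by
  have hgreatest : IsGreatest {R : ℝ | PBICM.IsAchievable W μ R}
      (L * (W.ditheredChannel μ).capacity) :=
    ⟨PBICM.isAchievable_capacity W μ, fun R hR => PBICM.IsAchievable.le_capacity W μ hR⟩
  have hcap : PBICM.pbicmCapacity W μ = L * (W.ditheredChannel μ).capacity := hgreatest.csSup_eq
  have hL : (L : ℝ) ≠ 0 := by exact_mod_cast NeZero.ne L
  refine ⟨hcap ▸ hgreatest, hcap, ?_, (W.bicmCapacity_eq μ).symm⟩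
  rw [W.capacity_ditheredChannel]
  field_simp
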